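/- **Setting.** Streams consist of updates $(i,\Delta)\in[n]\times\{-1,1\}$ to a vector $v\in\mathbb Z^n$ that is initially $0$; $m$ is an upper bound on the stream length. $Q'$ is a $(1\pm\beta)$-approximation to $Q$ if $(1-\beta)Q\le Q'\le(1+\beta)Q$. A streaming algorithm keeps a memory content between updates, initializes it, updates it and reports estimates from it using fresh random coins (reporting does not change the memory); it uses $S$ words of space, for a word length of $w$ bits, if its memory has at most $2^{wS}$ possible contents. In the $q$-query game an adaptive adversary chooses in each of $m$ rounds an update and whether to query the algorithm after it, depending on all previous updates and on all answers received so far, with at most $q$ queries in total. The algorithm is a $q$-query adversarially robust $(1\pm\alpha)$-approximation of $f$ with success probability $p$ if against every such adversary, with probability at least $p$, every answer is a $(1\pm\alpha)$-approximation of $f(v)$ at the time of the query. Let $\alpha,\delta\in(0,1)$, let $q\ge1$ be an integer and $\tau\ge1$. Let $f:\mathbb Z^n\to[0,\infty)$ take values in $\{0\}\cup[1,\tau]$ on all vectors produced by non-empty streams of at most $m$ updates. Let $\mathcal A$ be a streaming algorithm that uses $S$ words of space and that, on each fixed non-empty stream of at most $m$ updates, reports a $(1\pm\alpha/3)$-approximation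 of $f(v)$ with probability at least $9/10$ when queried once. **Algorithm.** Put $\varepsilon=1/100$, $\delta'=\varepsilon\delta/(10q)$, $\varepsilon'=\varepsilon/\sqrt{8q\ln(1/\delta')}$ and $k=\left\lceil C\,\varepsilon'^{-1}\log\frac{2q\log 2\tau}{\alpha\delta}\right\rceil$. Let $X$ consist of $0$ and the powers $(1+\alpha/3)^i\in[1,\tau]$, $i\ge0$. Run $k$ independent copies of $\mathcal A$ on the stream. At a query, take the current estimate of each copy, round it up to a power of $1+\alpha/3$ and truncate it to the range of the powers in $X$ (estimates that are at most $0$ become $0$), and output $M(\gamma'_1,\dots,\gamma'_k)$, with fresh randomness, where $\gamma'_1,\dots,\gamma'_k\in X$ are the results and $M:X^k\to X$ is a randomized mechanism that is an $(\varepsilon',0)$-differentially private median with failure probability $\frac{\delta}{2q}$ and error $\Gamma=c\,\varepsilon'^{-1}\log\frac{|X|}{\delta/(2q)}$: for all databases $D,D'\in X^k$ that differ in at most one row and all $T\subseteq X$, $\Pr[M(D)\in T]\le e^{\varepsilon'}\Pr[M(D')\in T]$, and for every $D\in X^k$, with probability at least $1-\frac{\delta}{2q}$, at least $k/2-\Gamma$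 rows of $D$ are $\ge M(D)$ and at least $k/2-\Gamma$ rows are $\le M(D)$. **Claim.** For every sufficiently large absolute constant $c$ and every $C$ that is sufficiently large depending only on $c$, there is a constant $K$ depending only on $c$ and $C$ such that for all parameters, $f$ and $\mathcal A$ as above: such a mechanism $M$ exists, and with every such $M$ the algorithm is a $q$-query adversarially robust $(1\pm\alpha)$-approximation of $f$ on streams of length at most $m$ with success probability $1-\delta$, and it uses at most $\chi\cdot S$ words of space, where $$\chi = K\,\sqrt{q\log(2q/\delta)}\;\log\frac{2q\log 2\tau}{\alpha\delta}.$$ -/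

import Mathlib

noncomputable section

namespace RobustStreaming

/-- `Q'` is a `(1 ± β)`-approximation to `Q`. -/
def IsApprox (β Q Q' : ℝ) : Prop := (1 - β) * Q ≤ Q' ∧ Q' ≤ (1 + β) * Q

/-- The probability of the event `E` under `p`. -/
def prob {Ω : Type*} (p : PMF Ω) (E : Set Ω) : ℝ := (p.toOuterMeasure E).toReal

/-- The joint law of `k` independent random variables with laws `p 0, …, p (k - 1)`. -/
def indep {Ω : Type} : (k : ℕ) → (Fin k → PMF Ω) → PMF (Fin k → Ω)
  | 0, _ => PMF.pure Fin.elim0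
  | k + 1, p => (p 0).bind fun a =>
      (indep k fun j => p j.succ).map fun t => (Fin.cons a t : Fin (k + 1) → Ω)

/-! ### Streaming algorithms -/

/-- An update `(i, Δ)` with `i ∈ [n]` and `Δ ∈ {-1, 1}`. -/
abbrev Update (n : ℕ) : Type := Fin n × ℤˣ

/-- The frequency vector produced by a stream of updates, starting from the zero vector. -/
def freq {n : ℕ} : List (Update n) → (Fin n → ℤ)
  | [] => 0
  | u :: us => freq us + Pi.single u.1 (u.2 : ℤ)

/-- A randomized streaming algorithm on frequency vectors of dimension `n`. A `State` is a content
of the whole memory that the algorithm keeps between two updates (stored random bits included).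
The algorithm flips fresh coins when it starts, when it processes an update, and when it reports an
estimate; reporting an estimate does not change the memory. -/
structure StreamAlg (n : ℕ) where
  State : Type
  init : PMF State
  step : State → Update n → PMF State
  out : State → PMF ℝ

namespace StreamAlg

variable {n : ℕ}

/-- `A` uses at most `S` words of `w` bits: its memory has at most `2 ^ (w S)` contents. -/
def UsesSpace (A : StreamAlg n) (w : ℕ) (S : ℝ) : Prop :=
  Finite A.State ∧ (Nat.card A.State : ℝ) ≤ (2 : ℝ) ^ ((w : ℝ) * S)

/-- The law of the memory after a fixed stream. Streams are listed with the newest update first. -/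
def run (A : StreamAlg n) : List (Update n) → PMF A.State
  | [] => A.init
  | u :: us => (A.run us).bind fun s => A.step s u

/-- The law of the estimate reported when `A` is queried (once) after a fixed stream. -/
def estimate (A : StreamAlg n) (us : List (Update n)) : PMF ℝ := (A.run us).bind A.out

/-- Oblivious correctness: on each fixed stream of at most `m` updates, `A` reports a
`(1 ± β)`-approximation of `f` with probability at least `p`. -/
def IsOblivious (A : StreamAlg n) (f : (Fin n → ℤ) → ℝ) (β : ℝ) (m : ℕ) (p : ℝ) : Prop :=
  ∀ us : List (Update n), us ≠ [] → us.length ≤ m →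
    p ≤ prob (A.estimate us) {y | IsApprox β (f (freq us)) y}

end StreamAlg

/-! ### The game against an adaptive adversary -/

/-- What the adversary has seen, newest round first: for each round the update that it sent, and
the output that it received if it made a query in that round. -/
abbrev History (n : ℕ) : Type := List (Update n × Option ℝ)

/-- The number of queries made so far. -/
def History.queries {n : ℕ} (h : History n) : ℕ := h.countP fun r => r.2.isSome

/-- A (possibly randomized) adversary: given the history it picks the next update and decides
whether it queries the algorithm after this update. -/
abbrev Adversary (n : ℕ) : Type := History n → PMF (Update n × Bool)

/-- The adversary makes at most `q` queries. -/
def Adversary.QueryBounded {n : ℕ} (adv : Adversary n) (q : ℕ) : Prop :=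
  ∀ h : History n, q ≤ h.queries → ∀ a ∈ (adv h).support, a.2 = false

/-- All queries in the history were answered by `(1 ± α)`-approximations of the value of `f` at the
frequency vector at the time of the query. -/
def AllCorrect {n : ℕ} (f : (Fin n → ℤ) → ℝ) (α : ℝ) : History n → Prop
  | [] => True
  | (_, none) :: h => AllCorrect f α h
  | (u, some y) :: h => IsApprox α (f (freq (u :: h.map Prod.fst))) y ∧ AllCorrect f α h

namespace StreamAlg

variable {n : ℕ}

/-- The joint law of the memory of the algorithm and the history after `j` rounds. -/
def play (B : StreamAlg n) (adv : Adversary n) : ℕ → PMF (B.State × History n)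
  | 0 => B.init.map fun s => (s, [])
  | j + 1 => (B.play adv j).bind fun x => (adv x.2).bind fun a => (B.step x.1 a.1).bind fun s =>
      if a.2 = true then (B.out s).map fun y => (s, (a.1, some y) :: x.2)
      else PMF.pure (s, (a.1, none) :: x.2)

/-- `B` is a `q`-query adversarially robust `(1 ± α)`-approximation algorithm for `f` on streams of
length `m`, with success probability at least `p`. -/
def IsRobust (B : StreamAlg n) (f : (Fin n → ℤ) → ℝ) (α : ℝ) (m q : ℕ) (p : ℝ) : Prop :=
  ∀ adv : Adversary n, adv.QueryBounded q → p ≤ prob (B.play adv m) {x | AllCorrect f α x.2}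

end StreamAlg

/-! ### Differentially private medians -/

/-- `(ε, δ)`-differential privacy of a randomized mechanism on databases with `k` rows. -/
def IsDP {k : ℕ} {X Y : Type*} (M : (Fin k → X) → PMF Y) (ε δ : ℝ) : Prop :=
  ∀ D D' : Fin k → X, (∃ i, ∀ j, j ≠ i → D j = D' j) →
    ∀ T : Set Y, prob (M D) T ≤ Real.exp ε * prob (M D') T + δ

/-- `M` is an `(ε, 0)`-DP median: with probability at least `1 - β` its output `x` is such that at
least `k / 2 - Γ` rows are at least `x` and at least `k / 2 - Γ` rows are at most `x`. -/
def IsDPMedian {k : ℕ} {X : Type*} [LinearOrder X] (M : (Fin k → X) → PMF X) (ε β Γ : ℝ) : Prop :=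
  IsDP M ε 0 ∧ ∀ D : Fin k → X, 1 - β ≤ prob (M D)
    {x | (k : ℝ) / 2 - Γ ≤ ((Finset.univ.filter fun i => x ≤ D i).card : ℝ) ∧
      (k : ℝ) / 2 - Γ ≤ ((Finset.univ.filter fun i => D i ≤ x).card : ℝ)}

/-! ### Rounding of the estimates -/

/-- The largest `i` with `(1 + α / 3) ^ i ≤ τ`. -/
def maxExp (α τ : ℝ) : ℕ := ⌊Real.logb (1 + α / 3) τ⌋₊

/-- The possible rounded estimates: `0` and the powers of `1 + α / 3` in `[1, τ]`. -/
def grid (α τ : ℝ) : Finset ℝ :=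
  insert 0 ((Finset.range (maxExp α τ + 1)).image fun i => (1 + α / 3) ^ i)

/-- A positive estimate is rounded up to a power of `1 + α / 3`, and then truncated to the range of
the powers that lie in `[1, τ]`. Nonpositive estimates become `0`. -/
def roundVal (α τ y : ℝ) : ℝ :=
  if y ≤ 0 then 0 else (1 + α / 3) ^ min ⌈Real.logb (1 + α / 3) y⌉₊ (maxExp α τ)

theorem roundVal_mem (α τ y : ℝ) : roundVal α τ y ∈ grid α τ := by
  unfold roundVal grid
  split_ifs
  · exact Finset.mem_insert_self _ _
  · exact Finset.mem_insert_of_mem (Finset.mem_image_of_mem _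
      (Finset.mem_range.2 (Nat.lt_succ_of_le (min_le_right _ _))))

/-- The rounded estimate as an element of the finite set `grid α τ`. -/
def roundGrid (α τ y : ℝ) : grid α τ := ⟨roundVal α τ y, roundVal_mem α τ y⟩

/-! ### The bounded query algorithm -/

/-- The privacy parameter `ε = 1 / 100` of the whole algorithm. -/
def epsTotal : ℝ := 1 / 100

/-- `δ' = ε δ / (10 q)`. -/
def deltaPrime (q : ℕ) (δ : ℝ) : ℝ := epsTotal * δ / (10 * q)

/-- `ε' = ε / √(8 q ln (1 / δ'))`, the privacy parameter of one median computation. -/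
def epsPrime (q : ℕ) (δ : ℝ) : ℝ :=
  epsTotal / Real.sqrt (8 * q * Real.log (1 / deltaPrime q δ))

/-- The number `k = ⌈C ε'⁻¹ log (2 q log (2 τ) / (α δ))⌉` of copies; `C` is the constant of the
`Θ`-notation. -/
def numCopies (C : ℝ) (q : ℕ) (α δ τ : ℝ) : ℕ :=
  ⌈C * (epsPrime q δ)⁻¹ * Real.log (2 * q * Real.log (2 * τ) / (α * δ))⌉₊

/-- The error `Γ = c ε'⁻¹ log (|X| / β)` of the median computation, where `X` is the set of possible
rounded estimates and `β = δ / (2 q)`; `c` is the constant of the `O`-notation. -/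
def medianError (c : ℝ) (q : ℕ) (α δ τ : ℝ) : ℝ :=
  c * (epsPrime q δ)⁻¹ * Real.log (((grid α τ).card : ℝ) / (δ / (2 * q)))

/-- The bounded query algorithm: it runs `k` independent copies of `A`, passes every update to all
of them, and answers a query by applying the private median mechanism `M` to the rounded estimates
of the copies. -/
def boundedQueryAlg {n : ℕ} (A : StreamAlg n) (α τ : ℝ) (k : ℕ)
    (M : (Fin k → grid α τ) → PMF (grid α τ)) : StreamAlg n where
  State := Fin k → A.State
  init := indep k fun _ => A.init
  step s u := indep k fun j => A.step (s j) u
  out s := ((indep k fun j => (A.out (s j)).map (roundGrid α τ)).bind M).map Subtype.val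

end RobustStreaming

end

open RobustStreaming

noncomputable section

namespace RobustStreaming

open scoped ENNReal

/-! ### Probabilities of events -/

section Prob

variable {α β : Type*}

/-! Why adaptivity does no harm: every answer depends on the copies only through a private median,
so the adversary learns little about any small group of copies, and such a group behaves almost as
if its coins were independent of the play.

All coins of a copy can be drawn in advance, as a table of rounded estimates indexed by streams
(`map_snd_play`). The tables are then i.i.d. rows, and each answer is `M` applied to one entry of
every row. On a fixed stream, a row is bad with probability at most `1/10`.

Fix a group `J` of `s` rows. Replacing these rows multiplies the second moment of the likelihood
ratio by at most `exp ((s ε') ^ 2)` per query (group privacy and Cauchy–Schwarz), so the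
probabilities `P`, `P'` of an event before and after the replacement satisfy `P ^ 2 ≤ Z * P'` with
`Z = exp (q (s ε') ^ 2) ≤ (128/125) ^ s` (`sq_prob_tableGame_le`, `exp_groupSize_le`). Fresh rows in
`J` are all bad at some query with probability at most `q (1/10) ^ s`; hence the original ones are
with probability at most `q (8/25) ^ s` (`prob_joint_le_of_resample`, `prob_someQuery_rows_bad_le`).
If about `9/20` of the rows are bad at one query, then at least a `(2/5) ^ s` fraction of all groups
is entirely bad, so averaging over the groups bounds this event by `q (4/5) ^ s ≤ δ / 2`
(`prob_many_rows_bad_le`).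

Otherwise, a successful median lies between two good rows and is itself good
(`isRobust_boundedQueryAlg`); median failures cost another `δ / 2`. The mechanism exists by the
exponential mechanism (`exists_isDPMedian`). -/

theorem outer_le_one (p : PMF α) (E : Set α) : p.toOuterMeasure E ≤ 1 := by
  rw [PMF.toOuterMeasure_apply, ← p.tsum_coe]
  exact ENNReal.tsum_le_tsum fun x => Set.indicator_le_self' (fun _ _ => zero_le) x

theorem outer_ne_top (p : PMF α) (E : Set α) : p.toOuterMeasure E ≠ ∞ :=
  ne_top_of_le_ne_top ENNReal.one_ne_top (outer_le_one p E)

theorem ofReal_prob (p : PMF α) (E : Set α) : ENNReal.ofReal (prob p E) = p.toOuterMeasure E :=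
  ENNReal.ofReal_toReal (outer_ne_top p E)

theorem prob_nonneg (p : PMF α) (E : Set α) : 0 ≤ prob p E := ENNReal.toReal_nonneg

theorem prob_le_one (p : PMF α) (E : Set α) : prob p E ≤ 1 := by
  simpa [prob] using ENNReal.toReal_mono ENNReal.one_ne_top (outer_le_one p E)

theorem prob_mono_support (p : PMF α) {E F : Set α} (h : ∀ x ∈ p.support, x ∈ E → x ∈ F) :
    prob p E ≤ prob p F :=
  ENNReal.toReal_mono (outer_ne_top p F) (p.toOuterMeasure_mono fun x hx => h x hx.2 hx.1)

theorem prob_mono (p : PMF α) {E F : Set α} (h : E ⊆ F) : prob p E ≤ prob p F :=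
  prob_mono_support p fun _ _ hx => h hx

theorem prob_union_le (p : PMF α) (E F : Set α) : prob p (E ∪ F) ≤ prob p E + prob p F := by
  unfold prob
  rw [← ENNReal.toReal_add (outer_ne_top p E) (outer_ne_top p F)]
  exact ENNReal.toReal_mono (ENNReal.add_ne_top.2 ⟨outer_ne_top p E, outer_ne_top p F⟩)
    (MeasureTheory.measure_union_le E F)

theorem prob_compl (p : PMF α) (E : Set α) : prob p Eᶜ = 1 - prob p E := by
  have h : p.toOuterMeasure E + p.toOuterMeasure Eᶜ = 1 := by
    rw [PMF.toOuterMeasure_apply, PMF.toOuterMeasure_apply, ← ENNReal.tsum_add, ← p.tsum_coe]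
    exact tsum_congr fun x => congrFun (Set.indicator_self_add_compl E p) x
  have := congrArg ENNReal.toReal h
  rw [ENNReal.toReal_add (outer_ne_top p E) (outer_ne_top p _), ENNReal.toReal_one] at this
  unfold prob
  linarith

theorem prob_pure (a : α) (E : Set α) [Decidable (a ∈ E)] :
    prob (PMF.pure a) E = if a ∈ E then 1 else 0 := by
  unfold prob
  rw [PMF.toOuterMeasure_pure_apply]
  split_ifs <;> simp

theorem prob_map (p : PMF α) (g : α → β) (E : Set β) : prob (p.map g) E = prob p (g ⁻¹' E) := by
  unfold prob
  rw [PMF.toOuterMeasure_map_apply]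

theorem prob_singleton (p : PMF α) (a : α) : prob p {a} = (p a).toReal := by
  unfold prob
  rw [PMF.toOuterMeasure_apply_singleton]

theorem sum_toReal [Fintype α] (p : PMF α) : ∑ a, (p a).toReal = 1 := by
  rw [← ENNReal.toReal_sum fun a _ => p.apply_ne_top a, ← tsum_fintype (L := .unconditional _),
    p.tsum_coe, ENNReal.toReal_one]

theorem prob_bind_fintype [Fintype α] (p : PMF α) (f : α → PMF β) (E : Set β) :
    prob (p.bind f) E = ∑ a, (p a).toReal * prob (f a) E := by
  unfold prob
  rw [PMF.toOuterMeasure_bind_apply, tsum_fintype,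
    ENNReal.toReal_sum fun a _ => ENNReal.mul_ne_top (p.apply_ne_top a) (outer_ne_top _ _)]
  simp

theorem prob_eq_sum [Fintype α] (p : PMF α) (E : Set α) [DecidablePred (· ∈ E)] :
    prob p E = ∑ a, if a ∈ E then (p a).toReal else 0 := by
  conv_lhs => rw [← p.bind_pure]
  rw [prob_bind_fintype]
  exact Finset.sum_congr rfl fun a _ => by rw [prob_pure]; simp

/-- An inequality that is affine in probabilities survives averaging. It serves both the linearized
second-moment bound and the addition of one query's failure probability to that of the later ones.
-/
theorem prob_bind_le_affine {γ : Type*} (p : PMF α) (f : α → PMF β) (g : α → PMF γ) (E : Set β)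
    (F : Set γ) {A B : ℝ} (hA : 0 ≤ A) (hB : 0 ≤ B)
    (h : ∀ a ∈ p.support, prob (f a) E ≤ A + B * prob (g a) F) :
    prob (p.bind f) E ≤ A + B * prob (p.bind g) F := by
  have key : (p.bind f).toOuterMeasure E
      ≤ ENNReal.ofReal A + ENNReal.ofReal B * (p.bind g).toOuterMeasure F := by
    rw [PMF.toOuterMeasure_bind_apply, PMF.toOuterMeasure_bind_apply, ← ENNReal.tsum_mul_left]
    calc ∑' a, p a * (f a).toOuterMeasure E
        ≤ ∑' a, (p a * ENNReal.ofReal A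
            + ENNReal.ofReal B * (p a * (g a).toOuterMeasure F)) := by
          refine ENNReal.tsum_le_tsum fun a => ?_
          by_cases ha : a ∈ p.support
          · rw [mul_left_comm, ← mul_add]
            gcongr
            rw [← ofReal_prob, ← ofReal_prob, ← ENNReal.ofReal_mul hB,
              ← ENNReal.ofReal_add hA (mul_nonneg hB (prob_nonneg _ _))]
            exact ENNReal.ofReal_le_ofReal (h a ha)
          · rw [(p.apply_eq_zero_iff a).2 ha]; simp
      _ = _ := by rw [ENNReal.tsum_add, ENNReal.tsum_mul_right, p.tsum_coe, one_mul]
  have hne : ENNReal.ofReal B * (p.bind g).toOuterMeasure F ≠ ∞ :=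
    ENNReal.mul_ne_top ENNReal.ofReal_ne_top (outer_ne_top _ _)
  have := ENNReal.toReal_mono (ENNReal.add_ne_top.2 ⟨ENNReal.ofReal_ne_top, hne⟩) key
  rwa [ENNReal.toReal_add ENNReal.ofReal_ne_top hne, ENNReal.toReal_mul,
    ENNReal.toReal_ofReal hA, ENNReal.toReal_ofReal hB] at this

theorem prob_bind_le (p : PMF α) (f : α → PMF β) (E : Set β) {A : ℝ} (hA : 0 ≤ A)
    (h : ∀ a ∈ p.support, prob (f a) E ≤ A) : prob (p.bind f) E ≤ A := by
  simpa using prob_bind_le_affine p f f E E hA le_rfl (by simpa using h)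

/-- Double counting: every point of `F` is counted at least `c` times on the right. -/
theorem nsmul_prob_le_sum {ι : Type*} (p : PMF α) (F : Set α) (S : Finset ι) (E : ι → Set α)
    (c : ℕ) (h : ∀ x ∈ F, ∃ T ⊆ S, c ≤ T.card ∧ ∀ J ∈ T, x ∈ E J) :
    c * prob p F ≤ ∑ J ∈ S, prob p (E J) := by
  have key : (c : ℝ≥0∞) * p.toOuterMeasure F ≤ ∑ J ∈ S, p.toOuterMeasure (E J) := by
    simp_rw [PMF.toOuterMeasure_apply]
    rw [← ENNReal.tsum_mul_left, ← Summable.tsum_finsetSum fun _ _ => ENNReal.summable]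
    refine ENNReal.tsum_le_tsum fun x => ?_
    by_cases hx : x ∈ F
    · obtain ⟨T, hTS, hc, hT⟩ := h x hx
      rw [Set.indicator_of_mem hx]
      calc (c : ℝ≥0∞) * p x ≤ T.card * p x := by gcongr
        _ = ∑ J ∈ T, (E J).indicator p x := by
          rw [← nsmul_eq_mul, ← Finset.sum_const]
          exact Finset.sum_congr rfl fun J hJ => (Set.indicator_of_mem (hT J hJ) _).symm
        _ ≤ _ := Finset.sum_le_sum_of_subset hTS
    · simp [hx]
  have := ENNReal.toReal_mono (ENNReal.sum_ne_top.2 fun J _ => outer_ne_top p (E J)) key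
  rwa [ENNReal.toReal_mul, ENNReal.toReal_natCast,
    ENNReal.toReal_sum fun J _ => outer_ne_top p (E J)] at this

end Prob

/-! ### Independent products -/

section Indep

variable {Ω Ω' : Type}

theorem indep_pure : ∀ (k : ℕ) (a : Fin k → Ω), (indep k fun j => PMF.pure (a j)) = PMF.pure a
  | 0, a => congrArg PMF.pure (Subsingleton.elim _ _)
  | k + 1, a => by
    rw [indep, PMF.pure_bind, indep_pure k, PMF.pure_map]
    exact congrArg PMF.pure (Fin.cons_self_tail a)

theorem indep_bind : ∀ (k : ℕ) (p : Fin k → PMF Ω) (f : Fin k → Ω → PMF Ω'),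
    (indep k fun j => (p j).bind (f j)) = (indep k p).bind fun t => indep k fun j => f j (t j)
  | 0, p, f => by simp [indep]
  | k + 1, p, f => by
    simp only [indep, PMF.bind_bind, indep_bind k (fun j => p j.succ), PMF.map_bind,
      PMF.bind_map, Function.comp_def, Fin.cons_zero, Fin.cons_succ]
    refine congrArg (PMF.bind (p 0)) (funext fun a => ?_)
    rw [PMF.bind_comm]

theorem indep_map (k : ℕ) (p : Fin k → PMF Ω) (f : Fin k → Ω → Ω') :
    (indep k fun j => (p j).map (f j)) = (indep k p).map fun t j => f j (t j) := by
  have := indep_bind k p fun j a => PMF.pure (f j a)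
  simp only [indep_pure] at this
  exact this

theorem map_eval_indep : ∀ (k : ℕ) (p : Fin k → PMF Ω) (i : Fin k),
    (indep k p).map (fun t => t i) = p i
  | k + 1, p, i => by
    rw [indep, PMF.map_bind]
    simp only [PMF.map_comp]
    refine Fin.cases ?_ (fun j => ?_) i
    · simp only [Function.comp_def, Fin.cons_zero]
      conv_rhs => rw [← (p 0).bind_pure]
      exact congrArg (PMF.bind (p 0)) (funext fun a => PMF.map_const _ _)
    · simp only [Function.comp_def, Fin.cons_succ, map_eval_indep k (fun j => p j.succ) j,
        PMF.bind_const]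

theorem prob_indep_pi : ∀ (k : ℕ) (p : Fin k → PMF Ω) (B : Fin k → Set Ω),
    prob (indep k p) {t | ∀ i, t i ∈ B i} = ∏ i, prob (p i) (B i)
  | 0, p, B => by
    classical
    simp [indep, prob_pure]
  | k + 1, p, B => by
    have h1 : (indep (k + 1) p).toOuterMeasure {t | ∀ i, t i ∈ B i}
        = (p 0).toOuterMeasure (B 0)
          * (indep k fun j => p j.succ).toOuterMeasure {t | ∀ i : Fin k, t i ∈ B i.succ} := by
      rw [indep, PMF.toOuterMeasure_bind_apply, PMF.toOuterMeasure_apply, ← ENNReal.tsum_mul_right]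
      refine tsum_congr fun a => ?_
      rw [PMF.toOuterMeasure_map_apply]
      by_cases ha : a ∈ B 0
      · rw [Set.indicator_of_mem ha]
        congr 2
        ext t
        simp [Fin.forall_fin_succ, ha]
      · rw [Set.indicator_of_notMem ha, zero_mul]
        convert mul_zero _
        convert MeasureTheory.measure_empty (μ := (indep k fun j => p j.succ).toOuterMeasure)
        ext t
        simp [Fin.forall_fin_succ, ha]
    have h2 := congrArg ENNReal.toReal h1
    rw [ENNReal.toReal_mul] at h2
    rw [Fin.prod_univ_succ, ← prob_indep_pi k (fun j => p j.succ) fun j => B j.succ]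
    exact h2

theorem prob_indep_forall_mem (k : ℕ) (p : Fin k → PMF Ω) (J : Finset (Fin k))
    (B : Fin k → Set Ω) {x : ℝ} (h : ∀ i ∈ J, prob (p i) (B i) ≤ x) :
    prob (indep k p) {t | ∀ i ∈ J, t i ∈ B i} ≤ x ^ J.card := by
  classical
  have h1 : {t : Fin k → Ω | ∀ i ∈ J, t i ∈ B i}
      = {t | ∀ i, t i ∈ if i ∈ J then B i else Set.univ} := by
    ext t
    refine forall_congr' fun i => ?_
    split_ifs with hi <;> simp [hi]
  have h2 : ∀ i, prob (p i) Set.univ = 1 := fun i => by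
    have := prob_compl (p i) ∅
    simpa [prob] using this
  rw [h1, prob_indep_pi]
  calc ∏ i, prob (p i) (if i ∈ J then B i else Set.univ)
      = ∏ i, if i ∈ J then prob (p i) (B i) else 1 :=
        Finset.prod_congr rfl fun i _ => by split_ifs <;> simp [h2]
    _ = ∏ i ∈ J, prob (p i) (B i) := by simp [Finset.prod_ite_mem]
    _ ≤ ∏ _i ∈ J, x := Finset.prod_le_prod (fun i _ => prob_nonneg _ _) h
    _ = x ^ J.card := by simp

/-- A finite family of independent random variables. -/
def indepFamily {ι : Type} [Fintype ι] (p : ι → PMF Ω) : PMF (ι → Ω) :=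
  (indep (Fintype.card ι) fun j => p ((Fintype.equivFin ι).symm j)).map fun t i =>
    t (Fintype.equivFin ι i)

theorem map_eval_indepFamily {ι : Type} [Fintype ι] (p : ι → PMF Ω) (i : ι) :
    (indepFamily p).map (fun t => t i) = p i := by
  rw [indepFamily, PMF.map_comp]
  have := map_eval_indep _ (fun j => p ((Fintype.equivFin ι).symm j)) (Fintype.equivFin ι i)
  rw [Equiv.symm_apply_apply] at this
  exact this

end Indep

/-! ### Changing several rows of the database -/

section DP

variable {k : ℕ} {X Y : Type*}

/-- Group privacy: the rows in `J` are changed one at a time, each at the cost of a factor `exp ε`.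
-/
theorem IsDP.apply_le {M : (Fin k → X) → PMF Y} {ε : ℝ} (hM : IsDP M ε 0) (J : Finset (Fin k)) :
    ∀ D D' : Fin k → X, (∀ i, i ∉ J → D i = D' i) → ∀ y,
      (M D y).toReal ≤ Real.exp (J.card * ε) * (M D' y).toReal := by
  classical
  induction J using Finset.induction_on with
  | empty =>
    intro D D' h y
    rw [funext fun i => h i (Finset.notMem_empty i)]
    simp
  | insert a J ha ih =>
    intro D D' h y
    have h1 := ih D (Function.update D' a (D a)) (fun i hi => by
      by_cases hia : i = a
      · subst hia; simp
      · simp [hia, h i (by simp [hia, hi])]) y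
    have h2 := hM (Function.update D' a (D a)) D' ⟨a, fun j hj => by simp [hj]⟩ {y}
    rw [prob_singleton, prob_singleton, add_zero] at h2
    rw [Finset.card_insert_of_notMem ha, Nat.cast_add, Nat.cast_one, add_mul, one_mul, Real.exp_add,
      mul_assoc]
    exact h1.trans (mul_le_mul_of_nonneg_left h2 (Real.exp_pos _).le)

end DP

/-! ### Second moments of likelihood ratios -/

/-- With `t = exp (x ^ 2 / 2)`, the bound `cosh x ≤ t` gives `2 t - 1 ≤ t ^ 2`. The exponent is
quadratic in `x`, which is what produces the `√q` in the final bound. -/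
theorem exp_add_exp_neg_sub_one_le (x : ℝ) :
    Real.exp x + Real.exp (-x) - 1 ≤ Real.exp (x ^ 2) := by
  have h1 := Real.cosh_le_exp_half_sq x
  rw [Real.cosh_eq] at h1
  have h2 : Real.exp (x ^ 2) = Real.exp (x ^ 2 / 2) ^ 2 := by
    rw [← Real.exp_nat_mul]; congr 1; push_cast; ring
  nlinarith [sq_nonneg (Real.exp (x ^ 2 / 2) - 1)]

/-- The second moment of the likelihood ratio of two distributions that are within a factor
`exp η` of each other. -/
theorem sum_sq_div_le {Y : Type*} [Fintype Y] (a b : Y → ℝ) (ha : ∀ y, 0 ≤ a y)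
    (hb : ∀ y, 0 ≤ b y) (ha1 : ∑ y, a y = 1) (hb1 : ∑ y, b y = 1) {η : ℝ}
    (hab : ∀ y, a y ≤ Real.exp η * b y) (hba : ∀ y, b y ≤ Real.exp η * a y) :
    ∑ y, a y ^ 2 / b y ≤ Real.exp (η ^ 2) := by
  refine le_trans ?_ (exp_add_exp_neg_sub_one_le η)
  -- Expansion of `(a - exp (-η) b) (exp η b - a) ≥ 0`, divided by `b`.
  have key : ∀ y, a y ^ 2 / b y ≤ (Real.exp η + Real.exp (-η)) * a y - b y := fun y => by
    rcases (hb y).eq_or_lt with h0 | h0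
    · have : a y = 0 := le_antisymm (by simpa [← h0] using hab y) (ha y)
      simp [← h0, this]
    · rw [div_le_iff₀ h0]
      have h1 : Real.exp (-η) * b y ≤ a y := by
        rw [Real.exp_neg, inv_mul_le_iff₀ (Real.exp_pos _)]; exact hba y
      have h2 : Real.exp η * Real.exp (-η) = 1 := by rw [← Real.exp_add]; simp
      have h3 := mul_nonneg (sub_nonneg.2 h1) (sub_nonneg.2 (hab y))
      have h4 : Real.exp η * Real.exp (-η) * b y ^ 2 = b y ^ 2 := by rw [h2, one_mul]
      linarith
  calc ∑ y, a y ^ 2 / b y ≤ ∑ y, ((Real.exp η + Real.exp (-η)) * a y - b y) :=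
        Finset.sum_le_sum fun y _ => key y
    _ = Real.exp η + Real.exp (-η) - 1 := by
        rw [Finset.sum_sub_distrib, ← Finset.mul_sum, ha1, hb1, mul_one]

/-- Change of measure at one query: `a` and `b` are the laws of the answer for two databases, `x`
and `z` the probabilities of an event in the two continuations. Cauchy–Schwarz costs only the second
moment `exp (η ^ 2)`. -/
theorem sq_sum_mul_le {Y : Type*} [Fintype Y] (a b x z : Y → ℝ) (ha : ∀ y, 0 ≤ a y)
    (hb : ∀ y, 0 ≤ b y) (ha1 : ∑ y, a y = 1) (hb1 : ∑ y, b y = 1) {η Z : ℝ}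
    (hab : ∀ y, a y ≤ Real.exp η * b y) (hba : ∀ y, b y ≤ Real.exp η * a y)
    (hxz : ∀ y, x y ^ 2 ≤ Z * z y) :
    (∑ y, a y * x y) ^ 2 ≤ Real.exp (η ^ 2) * Z * ∑ y, b y * z y := by
  calc (∑ y, a y * x y) ^ 2 ≤ (∑ y, a y ^ 2 / b y) * ∑ y, b y * x y ^ 2 := by
        refine Finset.sum_sq_le_sum_mul_sum_of_sq_le_mul _
          (fun y _ => div_nonneg (sq_nonneg _) (hb y))
          (fun y _ => mul_nonneg (hb y) (sq_nonneg _)) fun y _ => ?_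
        rcases (hb y).eq_or_lt with h0 | h0
        · have : a y = 0 := le_antisymm (by simpa [← h0] using hab y) (ha y)
          simp [this]
        · exact le_of_eq (by field_simp)
    _ ≤ Real.exp (η ^ 2) * ∑ y, b y * (Z * z y) := by
        refine mul_le_mul (sum_sq_div_le a b ha hb ha1 hb1 hab hba)
          (Finset.sum_le_sum fun y _ => mul_le_mul_of_nonneg_left (hxz y) (hb y))
          (Finset.sum_nonneg fun y _ => mul_nonneg (hb y) (sq_nonneg _)) (Real.exp_pos _).le
    _ = Real.exp (η ^ 2) * Z * ∑ y, b y * z y := by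
        rw [mul_assoc, Finset.mul_sum (a := Z)]
        exact congrArg _ (Finset.sum_congr rfl fun y _ => by ring)

/-! ### The game with fixed rows -/

section Game

variable {n k : ℕ} {α τ : ℝ}

/-- The history after `j` more rounds of the game in which a query is answered by applying `M` to
the database `D us`, where `us` lists the updates made from now on, oldest first. -/
def tableGame (adv : Adversary n) (M : (Fin k → grid α τ) → PMF (grid α τ)) :
    ℕ → (List (Update n) → Fin k → grid α τ) → History n → PMF (History n)
  | 0, _, h => PMF.pure h
  | j + 1, D, h => (adv h).bind fun a =>
      if a.2 = true then
        (M (D [a.1])).bind fun y =>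
          tableGame adv M j (fun us => D (a.1 :: us)) ((a.1, some y.val) :: h)
      else tableGame adv M j (fun us => D (a.1 :: us)) ((a.1, none) :: h)

variable {adv : Adversary n} {M : (Fin k → grid α τ) → PMF (grid α τ)}

theorem queries_cons_some (h : History n) (u : Update n) (y : ℝ) :
    History.queries ((u, some y) :: h) = History.queries h + 1 := by
  simp [History.queries]

theorem queries_cons_none (h : History n) (u : Update n) :
    History.queries ((u, none) :: h) = History.queries h := by
  simp [History.queries]

theorem Adversary.QueryBounded.lt_of_query {q : ℕ} (hq : adv.QueryBounded q) {h : History n}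
    {a : Update n × Bool} (ha : a ∈ (adv h).support) (ha2 : a.2 = true) : h.queries < q := by
  by_contra hh
  simp [hq h (not_lt.1 hh) a ha] at ha2

theorem tableGame_support {q : ℕ} (hq : adv.QueryBounded q) :
    ∀ (j : ℕ) (D : List (Update n) → Fin k → grid α τ) (h : History n), h.queries ≤ q →
      ∀ h' ∈ (tableGame adv M j D h).support, h'.queries ≤ q ∧ h'.length = h.length + j
  | 0, D, h, hh, h', hh' => by
    rw [tableGame, PMF.mem_support_pure_iff] at hh'
    subst hh'
    exact ⟨hh, rfl⟩
  | j + 1, D, h, hh, h', hh' => by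
    rw [tableGame, PMF.mem_support_bind_iff] at hh'
    obtain ⟨a, ha, hh'⟩ := hh'
    split_ifs at hh' with ha2
    · rw [PMF.mem_support_bind_iff] at hh'
      obtain ⟨y, -, hh'⟩ := hh'
      have := tableGame_support hq j _ _
        (by rw [queries_cons_some]; exact hq.lt_of_query ha ha2) h' hh'
      exact ⟨this.1, by rw [this.2, List.length_cons]; omega⟩
    · have := tableGame_support hq j _ _ (by rwa [queries_cons_none]) h' hh'
      exact ⟨this.1, by rw [this.2, List.length_cons]; omega⟩

/-- Induction over the rounds. At the end an indicator equals its square; the adversary's own choice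
costs nothing, by Cauchy–Schwarz with equal laws; each query costs one factor, so the exponent
counts the queries that remain. -/
theorem sq_prob_tableGame_le {q : ℕ} (hq : adv.QueryBounded q) {ε : ℝ} (hM : IsDP M ε 0)
    (J : Finset (Fin k)) (E : Set (History n)) :
    ∀ (j : ℕ) (D D' : List (Update n) → Fin k → grid α τ) (h : History n), h.queries ≤ q →
      (∀ us i, i ∉ J → D us i = D' us i) →
      prob (tableGame adv M j D h) E ^ 2 ≤
        Real.exp ((J.card * ε) ^ 2) ^ (q - h.queries) * prob (tableGame adv M j D' h) E
  | 0, D, D', h, hh, hD => by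
    classical
    rw [tableGame, tableGame, prob_pure]
    split_ifs
    · rw [one_pow, mul_one]
      exact one_le_pow₀ (Real.one_le_exp (sq_nonneg _))
    · simp
  | j + 1, D, D', h, hh, hD => by
    set Z := Real.exp ((J.card * ε) ^ 2) with hZ
    have hZ0 : 0 < Z := Real.exp_pos _
    rw [tableGame, tableGame, prob_bind_fintype, prob_bind_fintype]
    set w := fun a => ((adv h) a).toReal with hw
    have hw0 : ∀ a, 0 ≤ w a := fun a => ENNReal.toReal_nonneg
    set x : Update n × Bool → ℝ := fun a => prob (if a.2 = true then
        (M (D [a.1])).bind fun y =>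
          tableGame adv M j (fun us => D (a.1 :: us)) ((a.1, some y.val) :: h)
      else tableGame adv M j (fun us => D (a.1 :: us)) ((a.1, none) :: h)) E
    set z : Update n × Bool → ℝ := fun a => prob (if a.2 = true then
        (M (D' [a.1])).bind fun y =>
          tableGame adv M j (fun us => D' (a.1 :: us)) ((a.1, some y.val) :: h)
      else tableGame adv M j (fun us => D' (a.1 :: us)) ((a.1, none) :: h)) E
    -- The weight `w a` is kept because the query bound restricts only moves of positive
    -- probability.
    have hxz : ∀ a, w a * x a ^ 2 ≤ w a * (Z ^ (q - h.queries) * z a) := by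
      intro a
      by_cases ha : a ∈ (adv h).support
      · refine mul_le_mul_of_nonneg_left ?_ (hw0 a)
        by_cases ha2 : a.2 = true
        · have hlt := hq.lt_of_query ha ha2
          have hpow : Z ^ (q - h.queries) = Z * Z ^ (q - (h.queries + 1)) := by
            rw [← pow_succ']; congr 1; omega
          simp only [x, z, ha2, if_true]
          rw [prob_bind_fintype, prob_bind_fintype, hpow]
          refine sq_sum_mul_le _ _ _ _ (fun _ => ENNReal.toReal_nonneg)
            (fun _ => ENNReal.toReal_nonneg) (sum_toReal _) (sum_toReal _)
            (hM.apply_le J _ _ (hD _)) (hM.apply_le J _ _ fun i hi => (hD _ i hi).symm) fun y => ?_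
          have := sq_prob_tableGame_le hq hM J E j (fun us => D (a.1 :: us))
            (fun us => D' (a.1 :: us)) ((a.1, some y.val) :: h)
            (by rw [queries_cons_some]; omega) fun us i hi => hD _ i hi
          rwa [queries_cons_some] at this
        · simp only [x, z, ha2]
          have := sq_prob_tableGame_le hq hM J E j (fun us => D (a.1 :: us))
            (fun us => D' (a.1 :: us)) ((a.1, none) :: h)
            (by rwa [queries_cons_none]) fun us i hi => hD _ i hi
          rwa [queries_cons_none] at this
      · have : w a = 0 := by
          simp only [hw]
          rw [((adv h).apply_eq_zero_iff a).2 ha, ENNReal.toReal_zero]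
        simp [this]
    calc (∑ a, w a * x a) ^ 2 ≤ (∑ a, w a) * ∑ a, w a * x a ^ 2 :=
          Finset.sum_sq_le_sum_mul_sum_of_sq_le_mul _ (fun a _ => hw0 a)
            (fun a _ => mul_nonneg (hw0 a) (sq_nonneg _)) fun a _ => le_of_eq (by ring)
      _ ≤ 1 * ∑ a, w a * (Z ^ (q - h.queries) * z a) := by
          rw [show ∑ a, w a = 1 from sum_toReal _]
          exact mul_le_mul_of_nonneg_left (Finset.sum_le_sum fun a _ => hxz a) zero_le_one
      _ = Z ^ (q - h.queries) * ∑ a, w a * z a := by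
          rw [one_mul, Finset.mul_sum]
          exact Finset.sum_congr rfl fun a _ => by ring

/-- Some query in the history, made after the stream `us` (newest update first) and answered by
`y`, satisfies `P us y`. -/
def SomeQuery (P : List (Update n) → ℝ → Prop) : History n → Prop
  | [] => False
  | (_, none) :: h => SomeQuery P h
  | (u, some y) :: h => P (u :: h.map Prod.fst) y ∨ SomeQuery P h

theorem SomeQuery.mono {P Q : List (Update n) → ℝ → Prop} :
    ∀ {h : History n}, (∀ us y, us ≠ [] → us.length ≤ h.length → P us y → Q us y) →
      SomeQuery P h → SomeQuery Q h
  | [], _, hs => hs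
  | (_, none) :: h, hPQ, hs =>
    SomeQuery.mono (h := h) (fun us y h0 h1 => hPQ us y h0 (h1.trans (Nat.le_succ _))) hs
  | (u, some y) :: h, hPQ, hs => hs.imp (hPQ _ _ (List.cons_ne_nil _ _) (by simp))
      (SomeQuery.mono (h := h) fun us y h0 h1 => hPQ us y h0 (h1.trans (Nat.le_succ _)))

theorem SomeQuery.or {P Q : List (Update n) → ℝ → Prop} :
    ∀ {h : History n}, SomeQuery (fun us y => P us y ∨ Q us y) h → SomeQuery P h ∨ SomeQuery Q h
  | [], hs => hs.elim
  | (_, none) :: h, hs => SomeQuery.or (h := h) hs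
  | (u, some y) :: h, hs => by
    rcases hs with (hs | hs) | hs
    · exact Or.inl (Or.inl hs)
    · exact Or.inr (Or.inl hs)
    · exact (SomeQuery.or (h := h) hs).imp Or.inr Or.inr

/-- One query at which `P` holds supplies the same family `T` for the whole history. -/
theorem SomeQuery.exists_of_forall {ι : Type*} {P : List (Update n) → ℝ → Prop}
    {S : ι → Prop} {Q : ι → List (Update n) → ℝ → Prop} (c : ℕ)
    (hPQ : ∀ us y, P us y → ∃ T : Finset ι, (∀ J ∈ T, S J) ∧ c ≤ T.card ∧ ∀ J ∈ T, Q J us y) :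
    ∀ {h : History n}, SomeQuery P h →
      ∃ T : Finset ι, (∀ J ∈ T, S J) ∧ c ≤ T.card ∧ ∀ J ∈ T, SomeQuery (Q J) h
  | [], hs => hs.elim
  | (_, none) :: h, hs => SomeQuery.exists_of_forall c hPQ (h := h) hs
  | (u, some y) :: h, hs => by
    rcases hs with hs | hs
    · obtain ⟨T, h1, h2, h3⟩ := hPQ _ _ hs
      exact ⟨T, h1, h2, fun J hJ => Or.inl (h3 J hJ)⟩
    · obtain ⟨T, h1, h2, h3⟩ := SomeQuery.exists_of_forall c hPQ (h := h) hs
      exact ⟨T, h1, h2, fun J hJ => Or.inr (h3 J hJ)⟩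

theorem allCorrect_or_someQuery (f : (Fin n → ℤ) → ℝ) (β : ℝ) :
    ∀ h : History n, AllCorrect f β h ∨ SomeQuery (fun us y => ¬ IsApprox β (f (freq us)) y) h
  | [] => Or.inl trivial
  | (_, none) :: h => allCorrect_or_someQuery f β h
  | (u, some y) :: h => by
    rcases allCorrect_or_someQuery f β h with h1 | h1
    · by_cases h2 : IsApprox β (f (freq (u :: h.map Prod.fst))) y
      · exact Or.inl ⟨h2, h1⟩
      · exact Or.inr (Or.inl h2)
    · exact Or.inr (Or.inr h1)

/-- A union bound over the queries, for an event that is determined by independent randomness. -/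
theorem prob_someQuery_le {Ω : Type*} (p : PMF Ω) (P : Ω → List (Update n) → ℝ → Prop) {x : ℝ}
    {m : ℕ} (hP : ∀ us y, us ≠ [] → us.length ≤ m → prob p {t | P t us y} ≤ x) :
    ∀ h : History n, h.length ≤ m → prob p {t | SomeQuery (P t) h} ≤ h.queries * x
  | [], _ => by simp [SomeQuery, History.queries, prob]
  | (u, none) :: h, hh => by
    rw [queries_cons_none]
    exact prob_someQuery_le p P hP h ((Nat.le_succ _).trans hh)
  | (u, some y) :: h, hh => by
    rw [queries_cons_some]
    have h1 := prob_someQuery_le p P hP h ((Nat.le_succ _).trans hh)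
    have h2 := hP (u :: h.map Prod.fst) y (List.cons_ne_nil _ _) (by simpa using hh)
    refine (prob_union_le p {t | P t (u :: h.map Prod.fst) y} {t | SomeQuery (P t) h}).trans ?_
    push_cast
    linarith

/-- A union bound over the queries, for an event that concerns the coins of the mechanism. -/
theorem prob_tableGame_someQuery_le {q : ℕ} (hq : adv.QueryBounded q)
    (D₀ : List (Update n) → Fin k → grid α τ) (P : (Fin k → grid α τ) → ℝ → Prop) {x : ℝ}
    (hx : 0 ≤ x) (hP : ∀ D, prob (M D) {y | P D y.val} ≤ x) :
    ∀ (j : ℕ) (h : History n), h.queries ≤ q →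
      ¬ SomeQuery (fun us y => P (D₀ us.reverse) y) h →
      prob (tableGame adv M j (fun us => D₀ ((h.map Prod.fst).reverse ++ us)) h)
        {h' | SomeQuery (fun us y => P (D₀ us.reverse) y) h'} ≤ ((q : ℝ) - h.queries) * x
  | 0, h, hh, hs => by
    classical
    rw [tableGame, prob_pure, if_neg (by exact hs)]
    exact mul_nonneg (sub_nonneg.2 (by exact_mod_cast hh)) hx
  | j + 1, h, hh, hs => by
    classical
    have hnn : 0 ≤ ((q : ℝ) - h.queries) * x :=
      mul_nonneg (sub_nonneg.2 (by exact_mod_cast hh)) hx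
    rw [tableGame]
    refine prob_bind_le _ _ _ hnn fun a ha => ?_
    have hD : ∀ o : Option ℝ, (fun us => D₀ ((h.map Prod.fst).reverse ++ a.1 :: us))
        = fun us => D₀ ((((a.1, o) :: h).map Prod.fst).reverse ++ us) := fun o => by
      funext us
      simp
    split_ifs with ha2
    · have hlt := hq.lt_of_query ha ha2
      set d := D₀ ((h.map Prod.fst).reverse ++ [a.1]) with hd
      have hd' : d = D₀ (a.1 :: h.map Prod.fst).reverse := by simp [hd]
      -- The failure of the present answer enters as an indicator, so that averaging over `M d`
      -- turns it into a probability of at most `x`.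
      have hle : ∀ y ∈ (M d).support, prob (tableGame adv M j
          (fun us => D₀ ((h.map Prod.fst).reverse ++ a.1 :: us)) ((a.1, some y.val) :: h))
            {h' | SomeQuery (fun us y => P (D₀ us.reverse) y) h'}
          ≤ ((q : ℝ) - h.queries - 1) * x + 1 * prob (PMF.pure y) {y | P d y.val} := by
        intro y _
        have h1 : (0 : ℝ) ≤ (q : ℝ) - h.queries - 1 := by
          have : (h.queries : ℝ) + 1 ≤ q := by exact_mod_cast hlt
          linarith
        by_cases hy : P d y.val
        · rw [prob_pure, if_pos (show y ∈ {y | P d y.val} from hy)]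
          have := prob_le_one (tableGame adv M j
            (fun us => D₀ ((h.map Prod.fst).reverse ++ a.1 :: us)) ((a.1, some y.val) :: h))
            {h' | SomeQuery (fun us y => P (D₀ us.reverse) y) h'}
          nlinarith [mul_nonneg h1 hx]
        · rw [hD (some y.val)]
          refine (prob_tableGame_someQuery_le hq D₀ P hx hP j ((a.1, some y.val) :: h)
            (by rw [queries_cons_some]; omega) (by
              rintro (h2 | h2)
              · rw [← hd'] at h2
                exact hy h2
              · exact hs h2)).trans ?_
          rw [queries_cons_some]
          push_cast
          have := prob_nonneg (PMF.pure y) {y | P d y.val}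
          linarith
      have h1 : (0 : ℝ) ≤ (q : ℝ) - h.queries - 1 := by
        have : (h.queries : ℝ) + 1 ≤ q := by exact_mod_cast hlt
        linarith
      refine (prob_bind_le_affine (M d) _ _ _ _ (mul_nonneg h1 hx) zero_le_one hle).trans ?_
      rw [PMF.bind_pure]
      linarith [hP d]
    · rw [hD none]
      refine (prob_tableGame_someQuery_le hq D₀ P hx hP j ((a.1, none) :: h)
        (by rwa [queries_cons_none]) hs).trans ?_
      rw [queries_cons_none]

end Game

/-! ### Sampling all coins of an algorithm in advance -/

section Table

variable {n k : ℕ} {α τ : ℝ}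

/-- The table of all future estimates, from the present estimate and the tables of the successors
of the present state. The updates in the argument of a table are listed oldest first. -/
def consTable {X : Type} (o : X) (t : Update n → List (Update n) → X) : List (Update n) → X
  | [] => o
  | u :: us => t u us

/-- The law of the rounded estimates after each stream of at most `j + 1` further updates, where
the coins of the algorithm are flipped in advance for all possible updates. -/
def futureTables (A : StreamAlg n) (α τ : ℝ) :
    ℕ → A.State → PMF (Update n → List (Update n) → grid α τ)
  -- Default entries for streams beyond the horizon, which the game never reads.
  | 0, _ => PMF.pure fun _ _ => roundGrid α τ 0
  | j + 1, s => indepFamily fun u => (A.step s u).bind fun s' =>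
      ((A.out s').map (roundGrid α τ)).bind fun o =>
        (futureTables A α τ j s').map fun t => consTable o t

/-- The law of the rounded estimates after each stream of at most `j` further updates. -/
def tableLaw (A : StreamAlg n) (α τ : ℝ) (j : ℕ) (s : A.State) :
    PMF (List (Update n) → grid α τ) :=
  ((A.out s).map (roundGrid α τ)).bind fun o => (futureTables A α τ j s).map fun t => consTable o t

/-- A play makes only one of the possible next updates, so only this marginal matters; any coupling
of the successors would do. -/
theorem map_eval_futureTables (A : StreamAlg n) (j : ℕ) (s : A.State) (u : Update n) :
    (futureTables A α τ (j + 1) s).map (fun t => t u)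
      = (A.step s u).bind (tableLaw A α τ j) :=
  map_eval_indepFamily _ u

/-- The law of the state after some more updates, listed oldest first. -/
def runFrom (A : StreamAlg n) : List (Update n) → A.State → PMF A.State
  | [], s => PMF.pure s
  | u :: us, s => (A.step s u).bind (runFrom A us)

theorem runFrom_append (A : StreamAlg n) (u : Update n) : ∀ (us : List (Update n)) (s : A.State),
    runFrom A (us ++ [u]) s = (runFrom A us s).bind fun s' => A.step s' u
  | [], s => by simp [runFrom]
  | v :: us, s => by
    simp only [List.cons_append, runFrom, PMF.bind_bind]
    exact congrArg _ (funext fun s' => runFrom_append A u us s')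

theorem run_eq_runFrom (A : StreamAlg n) : ∀ us : List (Update n),
    A.run us = A.init.bind (runFrom A us.reverse)
  | [] => by
    simp only [List.reverse_nil, StreamAlg.run]
    exact (PMF.bind_pure _).symm
  | u :: us => by
    rw [StreamAlg.run, run_eq_runFrom A us, PMF.bind_bind, List.reverse_cons]
    exact congrArg _ (funext fun s => (runFrom_append A u _ s).symm)

theorem map_eval_tableLaw (A : StreamAlg n) : ∀ (us : List (Update n)) (j : ℕ) (s : A.State),
    us.length ≤ j → (tableLaw A α τ j s).map (fun t => t us)
      = (runFrom A us s).bind fun s' => (A.out s').map (roundGrid α τ)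
  | [], j, s, _ => by
    simp only [tableLaw, PMF.map_bind, PMF.map_comp, Function.comp_def, consTable, runFrom,
      PMF.pure_bind]
    conv_rhs => rw [← PMF.bind_pure ((A.out s).map (roundGrid α τ))]
    exact congrArg _ (funext fun o => PMF.map_const _ _)
  | u :: us, 0, s, h => by simp at h
  | u :: us, j + 1, s, h => by
    simp only [tableLaw, PMF.map_bind, PMF.map_comp, Function.comp_def, consTable, runFrom,
      PMF.bind_bind]
    rw [PMF.bind_const]
    have h1 : (futureTables A α τ (j + 1) s).map (fun t => t u us)
        = ((futureTables A α τ (j + 1) s).map (fun t => t u)).map fun t => t us := by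
      rw [PMF.map_comp]; rfl
    rw [h1, map_eval_futureTables, PMF.map_bind]
    exact congrArg _ (funext fun s' => map_eval_tableLaw A us j s' (Nat.le_of_succ_le_succ h))

/-- The joint law of the rounded estimates of a copy of `A` on all streams of length at most `m`. -/
def copyLaw (A : StreamAlg n) (α τ : ℝ) (m : ℕ) : PMF (List (Update n) → grid α τ) :=
  A.init.bind (tableLaw A α τ m)

/-- The entry at a fixed stream is distributed as an oblivious estimate; through this the hypothesis
on `A` enters. -/
theorem map_eval_copyLaw (A : StreamAlg n) {m : ℕ} (us : List (Update n)) (h : us.length ≤ m) :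
    (copyLaw A α τ m).map (fun t => t us.reverse) = (A.estimate us).map (roundGrid α τ) := by
  rw [copyLaw, PMF.map_bind, StreamAlg.estimate, run_eq_runFrom, PMF.bind_bind, PMF.map_bind]
  refine congrArg _ (funext fun s => ?_)
  rw [map_eval_tableLaw A _ _ _ (by simpa using h), PMF.map_bind]

/-! ### The game played from the first round on -/

/-- One round of the game. -/
def round (B : StreamAlg n) (adv : Adversary n) (x : B.State × History n) :
    PMF (B.State × History n) :=
  (adv x.2).bind fun a => (B.step x.1 a.1).bind fun s =>
    if a.2 = true then (B.out s).map fun y => (s, (a.1, some y) :: x.2)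
    else PMF.pure (s, (a.1, none) :: x.2)

/-- `j` more rounds of the game. -/
def rounds (B : StreamAlg n) (adv : Adversary n) : ℕ → B.State × History n →
    PMF (B.State × History n)
  | 0, x => PMF.pure x
  | j + 1, x => (round B adv x).bind (rounds B adv j)

theorem rounds_succ_last (B : StreamAlg n) (adv : Adversary n) : ∀ (j : ℕ) (x : B.State × History n),
    rounds B adv (j + 1) x = (rounds B adv j x).bind (round B adv)
  | 0, x => by
    simp only [rounds, PMF.pure_bind]
    exact PMF.bind_pure _
  | j + 1, x => by
    rw [rounds, rounds, PMF.bind_bind]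
    exact congrArg _ (funext fun y => rounds_succ_last B adv j y)

theorem play_eq_rounds (B : StreamAlg n) (adv : Adversary n) : ∀ j : ℕ,
    B.play adv j = B.init.bind fun s => rounds B adv j (s, [])
  | 0 => rfl
  | j + 1 => by
    rw [StreamAlg.play, play_eq_rounds B adv j, PMF.bind_bind]
    refine congrArg _ (funext fun s => ?_)
    rw [rounds_succ_last]
    rfl

/-- Deferred decisions: the stream grows in every round, so each table entry is read at most once
and may be drawn beforehand. Reporting leaves the memory unchanged, so an estimate may be drawn even
when no query is made. The present estimates `o` are arbitrary since queries come only after an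
update. -/
theorem map_snd_rounds (A : StreamAlg n) (M : (Fin k → grid α τ) → PMF (grid α τ))
    (adv : Adversary n) : ∀ (j : ℕ) (s : Fin k → A.State) (h : History n) (o : Fin k → grid α τ),
      (rounds (boundedQueryAlg A α τ k M) adv j (s, h)).map Prod.snd
        = (indep k fun i => futureTables A α τ j (s i)).bind fun t =>
            tableGame adv M j (fun us i => consTable (o i) (t i) us) h
  | 0, s, h, o => by simp [rounds, tableGame, PMF.pure_map]
  | j + 1, s, h, o => by
    simp only [rounds, tableGame, round, PMF.map_bind, PMF.bind_bind]
    -- The adversary's move depends on the history alone and can be drawn before the tables.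
    rw [PMF.bind_comm]
    refine congrArg _ (funext fun a => ?_)
    have hstep : ∀ F : (Fin k → List (Update n) → grid α τ) → PMF (History n),
        (indep k fun i => futureTables A α τ (j + 1) (s i)).bind (fun t => F fun i => t i a.1)
          = (indep k fun i => A.step (s i) a.1).bind fun s' =>
              (indep k fun i => (A.out (s' i)).map (roundGrid α τ)).bind fun o =>
                (indep k fun i => futureTables A α τ j (s' i)).bind fun t =>
                  F fun i => consTable (o i) (t i) := fun F => by
      have h1 := indep_map k (fun i => futureTables A α τ (j + 1) (s i)) fun _ t => t a.1
      simp only [map_eval_futureTables] at h1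
      have h2 := congrArg (fun p => PMF.bind p F) h1
      simp only [PMF.bind_map, Function.comp_def] at h2
      rw [← h2, indep_bind, PMF.bind_bind]
      refine congrArg _ (funext fun s' => ?_)
      simp only [tableLaw]
      rw [indep_bind, PMF.bind_bind]
      refine congrArg _ (funext fun o => ?_)
      rw [indep_map, PMF.bind_map]
      rfl
    have hF := hstep fun T => if a.2 = true then
        (M (fun i => T i [])).bind fun y =>
          tableGame adv M j (fun us i => T i us) ((a.1, some y.val) :: h)
      else tableGame adv M j (fun us i => T i us) ((a.1, none) :: h)
    refine Eq.trans ?_ hF.symm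
    change (indep k fun i => A.step (s i) a.1).bind _ = _
    refine congrArg _ (funext fun s' => ?_)
    split_ifs with ha2
    · change ((PMF.map _ (PMF.map Subtype.val (PMF.bind _ M))).bind _) = _
      simp only [PMF.bind_map, PMF.bind_bind, PMF.map_comp, Function.comp_def]
      refine congrArg _ (funext fun o => ?_)
      exact (congrArg _ (funext fun y => map_snd_rounds A M adv j s' _ o)).trans
        (PMF.bind_comm _ _ _)
    -- Without a query, unused estimates are drawn so that both sides have the same shape.
    · rw [PMF.pure_bind, ← PMF.bind_const (indep k fun i => (A.out (s' i)).map (roundGrid α τ))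
        (PMF.map Prod.snd _)]
      exact congrArg _ (funext fun o => map_snd_rounds A M adv j s' _ o)

theorem map_snd_play (A : StreamAlg n) (M : (Fin k → grid α τ) → PMF (grid α τ))
    (adv : Adversary n) (m : ℕ) :
    ((boundedQueryAlg A α τ k M).play adv m).map Prod.snd
      = (indep k fun _ => copyLaw A α τ m).bind fun t =>
          tableGame adv M m (fun us i => t i us) [] := by
  rw [play_eq_rounds, PMF.map_bind]
  unfold copyLaw
  rw [indep_bind, PMF.bind_bind]
  change (indep k fun _ => A.init).bind _ = _
  refine congrArg _ (funext fun s => ?_)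
  unfold tableLaw
  rw [indep_bind, PMF.bind_bind]
  rw [← PMF.bind_const (indep k fun i => (A.out (s i)).map (roundGrid α τ)) (PMF.map Prod.snd _)]
  refine congrArg _ (funext fun o => ?_)
  rw [indep_map, PMF.bind_map, map_snd_rounds A M adv m s [] o]
  rfl

end Table

/-! ### Events that depend on the rows and on the outcome of the game -/

section Joint

variable {Ω H : Type} {k : ℕ}

/-- The joint law of `T` and an outcome with law `G T`. -/
def joint (p : PMF Ω) (G : Ω → PMF H) : PMF (Ω × H) := p.bind fun T => (G T).map (Prod.mk T)

/-- Pushing the event forward to a law on `Prop` yields a plain bind, whose draws can be compared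
and exchanged. -/
theorem prob_joint (p : PMF Ω) (G : Ω → PMF H) (E : Ω → Set H) :
    prob (joint p G) {x | x.2 ∈ E x.1}
      = prob (p.bind fun T => (G T).map fun h => h ∈ E T) {P | P} := by
  have : (p.bind fun T => (G T).map fun h => h ∈ E T)
      = (joint p G).map fun x => x.2 ∈ E x.1 := by
    simp only [joint, PMF.map_bind, PMF.map_comp, Function.comp_def]
  rw [this, prob_map]
  rfl

/-- Two independent copies of a random variable. -/
def twoCopies (p : PMF Ω) : PMF (Ω × Ω) := p.bind fun a => p.map (Prod.mk a)

theorem map_swap_twoCopies (p : PMF Ω) : (twoCopies p).map Prod.swap = twoCopies p := by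
  simp only [twoCopies, PMF.map_bind, PMF.map_comp]
  exact PMF.bind_comm p p fun a b => PMF.pure (b, a)

theorem indep_twoCopies (k : ℕ) (p : PMF Ω) :
    (indep k fun _ => twoCopies p)
      = (indep k fun _ => p).bind fun T => (indep k fun _ => p).map fun T' i => (T i, T' i) := by
  unfold twoCopies
  rw [indep_bind]
  exact congrArg _ (funext fun T => indep_map k (fun _ => p) fun i b => (T i, b))

/-- If replacing the rows in `J` changes the law of the outcome only by a bounded second moment of
the likelihood ratio, then the rows in `J` can be replaced by fresh ones in the analysis of an event
that depends on these rows and on the outcome. -/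
theorem prob_joint_le_of_resample (p : PMF Ω) (G : (Fin k → Ω) → PMF H) (J : Finset (Fin k))
    (E : (Fin k → Ω) → Set H) {Z r l : ℝ} (hZ : 0 ≤ Z) (hr : 0 ≤ r) (hl : 0 < l)
    (hG : ∀ T T' : Fin k → Ω, (∀ i, i ∉ J → T i = T' i) →
      ∀ F, prob (G T) F ^ 2 ≤ Z * prob (G T') F)
    (hE : ∀ T T' : Fin k → Ω, (∀ i ∈ J, T i = T' i) → E T = E T')
    (hR : ∀ T, ∀ h ∈ (G T).support, prob (indep k fun _ => p) {T' | h ∈ E T'} ≤ r) :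
    prob (joint (indep k fun _ => p) G) {x | x.2 ∈ E x.1} ≤ l / 2 + Z / (2 * l) * r := by
  classical
  set P := indep k fun _ => p with hP
  set P₂ := indep k fun _ => twoCopies p with hP₂
  have hfst : P = P₂.map fun T i => (T i).1 := by
    rw [hP₂, indep_twoCopies, PMF.map_bind]
    simp only [PMF.map_comp, Function.comp_def]
    conv_lhs => rw [← P.bind_pure]
    exact congrArg _ (funext fun T => (PMF.map_const _ _).symm)
  -- Every row is drawn twice; exchanging the two copies inside `J` preserves the joint law.
  set sw : (Fin k → Ω × Ω) → Fin k → Ω × Ω := fun T i => if i ∈ J then (T i).swap else T i with hsw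
  have hswap : P₂ = P₂.map sw := by
    have := indep_map k (fun _ => twoCopies p) fun i x => if i ∈ J then x.swap else x
    rw [hP₂]
    refine Eq.trans ?_ this
    congr 1
    funext i
    split_ifs
    · exact (map_swap_twoCopies p).symm
    · exact (PMF.map_id _).symm
  rw [prob_joint]
  -- `a ^ 2 ≤ Z b` is linearized to `a ≤ l / 2 + Z b / (2 l)` by AM-GM, so that it can be averaged
  -- over the rows.
  have h1 : prob (P.bind fun T => (G T).map fun h => h ∈ E T) {P | P}
      ≤ l / 2 + Z / (2 * l) * prob (P₂.bind fun T =>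
          (G fun i => (sw T i).1).map fun h => h ∈ E fun i => (T i).1) {P | P} := by
    rw [hfst, PMF.bind_map]
    refine prob_bind_le_affine _ _ _ _ _ (by positivity) (by positivity) fun T _ => ?_
    have h2 := hG (fun i => (T i).1) (fun i => (sw T i).1)
      (fun i hi => by simp [hsw, hi]) (E fun i => (T i).1)
    simp only [Function.comp_def, prob_map]
    change prob _ (E fun i => (T i).1) ≤ l / 2 + Z / (2 * l) * prob _ (E fun i => (T i).1)
    rw [div_mul_eq_mul_div, div_add_div _ _ two_ne_zero (by positivity), le_div_iff₀ (by positivity)]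
    nlinarith [sq_nonneg (prob (G fun i => (T i).1) (E fun i => (T i).1) - l)]
  refine h1.trans ?_
  gcongr
  rw [hswap, PMF.bind_map]
  -- After the exchange the game sees only first copies and the event only second copies, which are
  -- independent.
  have h3 : ∀ T : Fin k → Ω × Ω, ((G fun i => (sw (sw T) i).1).map fun h =>
      h ∈ E fun i => (sw T i).1)
        = (G fun i => (T i).1).map fun h => h ∈ E fun i => (T i).2 := fun T => by
    rw [hE (fun i => (sw T i).1) (fun i => (T i).2) fun i hi => by simp [hsw, hi]]
    congr 2
    funext i
    by_cases hi : i ∈ J <;> simp [hsw, hi]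
  simp only [Function.comp_def, h3]
  rw [hP₂, indep_twoCopies, PMF.bind_bind]
  refine prob_bind_le _ _ _ hr fun T _ => ?_
  rw [PMF.bind_map]
  simp only [Function.comp_def]
  rw [show (P.bind fun T' => (G T).map fun h => h ∈ E T')
      = (G T).bind fun h => P.map fun T' => h ∈ E T' from
    PMF.bind_comm P (G T) fun T' h => PMF.pure (h ∈ E T')]
  refine prob_bind_le _ _ _ hr fun h hh => ?_
  rw [prob_map]
  exact hR T h hh

end Joint

/-! ### Robustness of the bounded query algorithm -/

section Robust

variable {n k : ℕ} {α τ : ℝ}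

theorem prob_someQuery_rows_bad_le {adv : Adversary n}
    {M : (Fin k → grid α τ) → PMF (grid α τ)} {q m : ℕ} (hq1 : 1 ≤ q) (hq : adv.QueryBounded q)
    {ε : ℝ} (hM : IsDP M ε 0)
    (p : PMF (List (Update n) → grid α τ)) (bad : List (Update n) → grid α τ → Prop)
    (hbad : ∀ us, us ≠ [] → us.length ≤ m → prob p {t | bad us (t us.reverse)} ≤ 1 / 10)
    (J : Finset (Fin k)) (hZ : Real.exp ((J.card * ε) ^ 2) ^ q ≤ (128 / 125) ^ J.card) :
    prob (joint (indep k fun _ => p) fun T => tableGame adv M m (fun us i => T i us) [])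
      {x | SomeQuery (fun us _ => ∀ i ∈ J, bad us (x.1 i us.reverse)) x.2}
        ≤ q * (8 / 25) ^ J.card := by
  set s := J.card with hs
  have hq1' : (1 : ℝ) ≤ q := by exact_mod_cast hq1
  have hr : ∀ h : History n, h.queries ≤ q → h.length ≤ m → prob (indep k fun _ => p)
      {T | SomeQuery (fun us _ => ∀ i ∈ J, bad us (T i us.reverse)) h} ≤ q * (1 / 10) ^ s := by
    intro h h1 h2
    refine (prob_someQuery_le (indep k fun _ => p)
      (fun T us _ => ∀ i ∈ J, bad us (T i us.reverse)) (x := (1 / 10) ^ s)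
      (fun us _ h0 hm => ?_) h h2).trans ?_
    · exact prob_indep_forall_mem k (fun _ => p) J (fun _ => {t | bad us (t us.reverse)})
        fun i _ => hbad us h0 hm
    · gcongr
  -- This `l` balances the two terms: `(8/25) ^ 2 = (128/125) * (1/10)`.
  have hl : (0 : ℝ) < (8 / 25) ^ s := by positivity
  refine (prob_joint_le_of_resample p _ J
    (fun T => {h | SomeQuery (fun us _ => ∀ i ∈ J, bad us (T i us.reverse)) h})
    (Z := (128 / 125) ^ s) (r := q * (1 / 10) ^ s) (by positivity) (by positivity) hl
    (fun T T' hT F => ?_) (fun T T' hT => ?_) fun T h hh => ?_).trans ?_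
  · refine (sq_prob_tableGame_le hq hM J F m (fun us i => T i us) (fun us i => T' i us) []
      (Nat.zero_le _) fun us i hi => congrFun (hT i hi) us).trans ?_
    exact mul_le_mul_of_nonneg_right hZ (prob_nonneg _ _)
  · have : ∀ us : List (Update n), (∀ i ∈ J, bad us (T i us.reverse))
        ↔ ∀ i ∈ J, bad us (T' i us.reverse) := fun us =>
      forall₂_congr fun i hi => by rw [hT i hi]
    simp only [this]
  · have := tableGame_support hq m _ [] (Nat.zero_le _) h hh
    exact hr h this.1 (by rw [this.2]; simp)
  · have h1 : (128 / 125 : ℝ) ^ s / (2 * (8 / 25) ^ s) * (q * (1 / 10) ^ s)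
        = q * (8 / 25) ^ s / 2 := by
      have : (128 / 125 : ℝ) ^ s * (1 / 10) ^ s = (8 / 25) ^ s * (8 / 25) ^ s := by
        rw [← mul_pow, ← mul_pow]; norm_num
      rw [div_mul_eq_mul_div, div_eq_div_iff (by positivity) (by positivity)]
      linear_combination (2 * (q : ℝ)) * this
    rw [h1]
    nlinarith

/-- A set of `b` bad rows contains `b.choose s` bad groups. Averaging over all `k.choose s` groups,
instead of a union bound over sets of size `b`, loses only `(5/2) ^ s`, and `5/2 * 8/25 = 4/5`. -/
theorem prob_many_rows_bad_le {adv : Adversary n}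
    {M : (Fin k → grid α τ) → PMF (grid α τ)} {q m : ℕ} (hq1 : 1 ≤ q) (hq : adv.QueryBounded q)
    {ε : ℝ} (hM : IsDP M ε 0)
    (p : PMF (List (Update n) → grid α τ)) (bad : List (Update n) → grid α τ → Prop)
    (hbad : ∀ us, us ≠ [] → us.length ≤ m → prob p {t | bad us (t us.reverse)} ≤ 1 / 10)
    {s b : ℕ} (hsb : s ≤ b) (hZ : Real.exp ((s * ε) ^ 2) ^ q ≤ (128 / 125) ^ s)
    (hchoose : (k.choose s : ℝ) ≤ (5 / 2) ^ s * b.choose s) :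
    prob (joint (indep k fun _ => p) fun T => tableGame adv M m (fun us i => T i us) [])
      {x | SomeQuery (fun us _ => ∃ B : Finset (Fin k), B.card = b ∧
        ∀ i ∈ B, bad us (x.1 i us.reverse)) x.2} ≤ q * (4 / 5) ^ s := by
  have h1 := nsmul_prob_le_sum
    (joint (indep k fun _ => p) fun T => tableGame adv M m (fun us i => T i us) [])
    {x | SomeQuery (fun us _ => ∃ B : Finset (Fin k), B.card = b ∧
        ∀ i ∈ B, bad us (x.1 i us.reverse)) x.2}
    (Finset.powersetCard s Finset.univ)
    (fun J => {x | SomeQuery (fun us _ => ∀ i ∈ J, bad us (x.1 i us.reverse)) x.2})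
    (b.choose s) (fun x hx => by
      obtain ⟨T, hT, hc, hT'⟩ := SomeQuery.exists_of_forall
        (S := fun J : Finset (Fin k) => J ∈ Finset.powersetCard s Finset.univ)
        (Q := fun J us _ => ∀ i ∈ J, bad us (x.1 i us.reverse)) (b.choose s) (by
          rintro us - ⟨B, hB, hB'⟩
          refine ⟨Finset.powersetCard s B, fun J hJ => ?_, ?_, fun J hJ i hi => ?_⟩
          · exact Finset.powersetCard_mono (Finset.subset_univ B) hJ
          · rw [Finset.card_powersetCard, hB]
          · exact hB' i ((Finset.mem_powersetCard.1 hJ).1 hi)) hx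
      exact ⟨T, hT, hc, hT'⟩)
  have h2 : ∑ J ∈ Finset.powersetCard s (Finset.univ : Finset (Fin k)),
      prob (joint (indep k fun _ => p) fun T => tableGame adv M m (fun us i => T i us) [])
        {x | SomeQuery (fun us _ => ∀ i ∈ J, bad us (x.1 i us.reverse)) x.2}
      ≤ k.choose s * (q * (8 / 25) ^ s) := by
    have hcard : (Finset.powersetCard s (Finset.univ : Finset (Fin k))).card = k.choose s := by
      rw [Finset.card_powersetCard, Finset.card_univ, Fintype.card_fin]
    rw [← hcard, ← nsmul_eq_mul]
    refine Finset.sum_le_card_nsmul _ _ _ fun J hJ => ?_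
    have hJ' := (Finset.mem_powersetCard.1 hJ).2
    have := prob_someQuery_rows_bad_le hq1 hq hM p bad hbad J (by rw [hJ']; exact hZ)
    rwa [hJ'] at this
  have hpos : (0 : ℝ) < b.choose s := by exact_mod_cast Nat.choose_pos hsb
  refine le_of_mul_le_mul_left ((h1.trans h2).trans ?_) hpos
  calc (k.choose s : ℝ) * (q * (8 / 25) ^ s)
      ≤ ((5 / 2) ^ s * b.choose s) * (q * (8 / 25) ^ s) := by gcongr
    _ = b.choose s * (q * ((5 / 2) ^ s * (8 / 25) ^ s)) := by ring
    _ = b.choose s * (q * (4 / 5) ^ s) := by rw [← mul_pow]; norm_num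

/-- Rounding up costs a factor `1 + α / 3`, and `(1 + α / 3) ^ 2 ≤ 1 + α`. Truncation is harmless:
the largest power is at least `τ / (1 + α / 3)`, hence at least `(1 - α) Q`. -/
theorem isApprox_roundVal {Q y : ℝ} (hα : 0 < α) (hα1 : α < 1)
    (hQ : Q = 0 ∨ (1 ≤ Q ∧ Q ≤ τ)) (h : IsApprox (α / 3) Q y) :
    IsApprox α Q (roundVal α τ y) := by
  obtain ⟨h1, h2⟩ := h
  rcases hQ with rfl | ⟨hQ1, hQτ⟩
  · have : y = 0 := by linarith
    simp [IsApprox, roundVal, this]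
  have hb : 1 < 1 + α / 3 := by linarith
  have hb0 : 0 < 1 + α / 3 := by linarith
  have hy : 0 < y := by nlinarith
  have hτ : 0 < τ := by linarith
  rw [roundVal, if_neg (not_le.2 hy)]
  set a := Real.logb (1 + α / 3) y with ha
  have hya : (1 + α / 3) ^ a = y := Real.rpow_logb hb0 hb.ne' hy
  constructor
  · rcases le_total ⌈a⌉₊ (maxExp α τ) with hm | hm
    · rw [min_eq_left hm]
      have : y ≤ (1 + α / 3) ^ ⌈a⌉₊ := by
        rw [← hya, ← Real.rpow_natCast]
        exact Real.rpow_le_rpow_of_exponent_le hb.le (Nat.le_ceil a)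
      nlinarith
    · rw [min_eq_right hm]
      have h3 : τ ≤ (1 + α / 3) ^ (maxExp α τ + 1) := by
        rw [← Real.rpow_natCast]
        conv_lhs => rw [← Real.rpow_logb hb0 hb.ne' hτ]
        refine Real.rpow_le_rpow_of_exponent_le hb.le ?_
        push_cast
        exact (Nat.lt_floor_add_one _).le
      rw [pow_succ] at h3
      have h4 : 0 < (1 + α / 3) ^ maxExp α τ := by positivity
      have h5 : (1 - α) * (1 + α / 3) ≤ 1 := by nlinarith
      have h6 : (1 - α) * Q * (1 + α / 3) ≤ (1 + α / 3) ^ maxExp α τ * (1 + α / 3) := by nlinarith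
      exact le_of_mul_le_mul_right h6 hb0
  · have h3 : (1 + α / 3) ^ min ⌈a⌉₊ (maxExp α τ) ≤ (1 + α / 3) ^ ⌈a⌉₊ :=
      pow_le_pow_right₀ hb.le (min_le_left _ _)
    refine h3.trans ?_
    -- For `y ≤ 1` the natural-number ceiling is `0` and the rounded value is `1 ≤ Q`.
    rcases le_or_gt a 0 with h0 | h0
    · rw [Nat.ceil_eq_zero.2 h0, pow_zero]
      nlinarith
    · have h4 : (1 + α / 3) ^ ⌈a⌉₊ ≤ y * (1 + α / 3) := by
        rw [← hya, ← Real.rpow_natCast]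
        conv_rhs => rw [← Real.rpow_add_one hb0.ne']
        exact Real.rpow_le_rpow_of_exponent_le hb.le (Nat.ceil_lt_add_one h0.le).le
      have h5 : (1 + α / 3) * (1 + α / 3) ≤ 1 + α := by nlinarith
      nlinarith

theorem exists_good_of_card {ι : Type*} [Fintype ι] {bad R : ι → Prop} [DecidablePred R] {b : ℕ}
    (hbad : ¬ ∃ B : Finset ι, B.card = b ∧ ∀ i ∈ B, bad i)
    (hR : b ≤ (Finset.univ.filter R).card) : ∃ i, ¬ bad i ∧ R i := by
  by_contra! hcon
  obtain ⟨B, hB, hBc⟩ := Finset.exists_subset_card_eq hR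
  exact hbad ⟨B, hBc, fun i hi => by_contra fun h => hcon i h (Finset.mem_filter.1 (hB hi)).2⟩

/-- If no `b` rows are bad and the median succeeds, then `b ≤ k / 2 - Γ` yields a good row above the
answer and one below it. The approximations of a number form an interval, so the answer is good. -/
theorem isRobust_boundedQueryAlg (f : (Fin n → ℤ) → ℝ) (A : StreamAlg n) {m q : ℕ} {ε β Γ : ℝ}
    (hq1 : 1 ≤ q) (hα : 0 < α) (hα1 : α < 1) (hβ : 0 ≤ β)
    (hf : ∀ us : List (Update n), us ≠ [] → us.length ≤ m →
      f (freq us) = 0 ∨ (1 ≤ f (freq us) ∧ f (freq us) ≤ τ))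
    (hA : A.IsOblivious f (α / 3) m (9 / 10))
    {M : (Fin k → grid α τ) → PMF (grid α τ)} (hM : IsDPMedian M ε β Γ)
    {s b : ℕ} (hsb : s ≤ b) (hbΓ : (b : ℝ) ≤ k / 2 - Γ)
    (hZ : Real.exp ((s * ε) ^ 2) ^ q ≤ (128 / 125) ^ s)
    (hchoose : (k.choose s : ℝ) ≤ (5 / 2) ^ s * b.choose s) :
    (boundedQueryAlg A α τ k M).IsRobust f α m q (1 - (q * (4 / 5) ^ s + q * β)) := by
  classical
  intro adv hadv
  set bad : List (Update n) → grid α τ → Prop := fun us x => ¬ IsApprox α (f (freq us)) x.val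
  have hbad : ∀ us, us ≠ [] → us.length ≤ m →
      prob (copyLaw A α τ m) {t | bad us (t us.reverse)} ≤ 1 / 10 := by
    intro us h0 hm
    have h1 : prob (copyLaw A α τ m) {t | bad us (t us.reverse)}
        = prob ((A.estimate us).map (roundGrid α τ)) {x | bad us x} := by
      rw [← map_eval_copyLaw A us hm, prob_map]
      rfl
    have h2 := hA us h0 hm
    have h3 : prob (A.estimate us) {y | IsApprox (α / 3) (f (freq us)) y}
        ≤ prob (A.estimate us) {y | bad us (roundGrid α τ y)}ᶜ :=
      prob_mono _ fun y hy => not_not.2 (isApprox_roundVal hα hα1 (hf us h0 hm) hy)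
    rw [prob_compl] at h3
    rw [h1, prob_map]
    change prob (A.estimate us) {y | bad us (roundGrid α τ y)} ≤ 1 / 10
    linarith
  set P := joint (indep k fun _ => copyLaw A α τ m)
    fun T => tableGame adv M m (fun us i => T i us) [] with hP
  set medOK : (Fin k → grid α τ) → ℝ → Prop := fun D y =>
    (k : ℝ) / 2 - Γ ≤ ((Finset.univ.filter fun i => y ≤ (D i).val).card : ℝ) ∧
      (k : ℝ) / 2 - Γ ≤ ((Finset.univ.filter fun i => (D i).val ≤ y).card : ℝ) with hmed
  have hplay : ((boundedQueryAlg A α τ k M).play adv m).map Prod.snd = P.map Prod.snd := by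
    rw [map_snd_play, hP, joint, PMF.map_bind]
    simp only [PMF.map_comp]
    exact congrArg _ (funext fun T => (PMF.map_id _).symm)
  have hgoal : prob ((boundedQueryAlg A α τ k M).play adv m) {x | AllCorrect f α x.2}
      = 1 - prob P {x | AllCorrect f α x.2}ᶜ := by
    rw [prob_compl, sub_sub_cancel]
    have h1 := prob_map ((boundedQueryAlg A α τ k M).play adv m) Prod.snd {h | AllCorrect f α h}
    have h2 := prob_map P Prod.snd {h | AllCorrect f α h}
    rw [hplay] at h1
    exact h1.symm.trans h2
  have hlen : ∀ x ∈ P.support, x.2.length ≤ m := by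
    intro x hx
    rw [hP, joint, PMF.mem_support_bind_iff] at hx
    obtain ⟨T, -, hx⟩ := hx
    rw [PMF.mem_support_map_iff] at hx
    obtain ⟨h, hh, rfl⟩ := hx
    have := (tableGame_support hadv m _ [] (Nat.zero_le _) h hh).2
    simp [this]
  have hsub : prob P {x | AllCorrect f α x.2}ᶜ ≤ prob P
      ({x | SomeQuery (fun us _ => ∃ B : Finset (Fin k), B.card = b ∧
          ∀ i ∈ B, bad us (x.1 i us.reverse)) x.2} ∪
        {x | SomeQuery (fun us y => ¬ medOK (fun i => x.1 i us.reverse) y) x.2}) := by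
    refine prob_mono_support P fun x hx hxc => ?_
    have h1 := (allCorrect_or_someQuery f α x.2).resolve_left hxc
    refine SomeQuery.or (SomeQuery.mono (fun us y h0 hm hy => ?_) h1)
    by_contra hcon
    rw [not_or, not_not] at hcon
    obtain ⟨hc1, hc2, hc3⟩ := hcon
    obtain ⟨i, hi, hi'⟩ := exists_good_of_card (bad := fun i => bad us (x.1 i us.reverse)) hc1
      (by exact_mod_cast hbΓ.trans hc2)
    obtain ⟨j, hj, hj'⟩ := exists_good_of_card (bad := fun i => bad us (x.1 i us.reverse)) hc1
      (by exact_mod_cast hbΓ.trans hc3)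
    exact hy ⟨(not_not.1 hj).1.trans hj', hi'.trans (not_not.1 hi).2⟩
  have hfail : prob P {x | SomeQuery (fun us y => ¬ medOK (fun i => x.1 i us.reverse) y) x.2}
      ≤ q * β := by
    rw [hP, joint]
    refine prob_bind_le _ _ _ (by positivity) fun T _ => ?_
    rw [prob_map]
    refine (prob_tableGame_someQuery_le hadv (fun us i => T i us) (fun D y => ¬ medOK D y) hβ
      (fun D => ?_) m [] (Nat.zero_le _) (fun h => h)).trans (by simp [History.queries])
    have h1 := hM.2 D
    have h2 := prob_compl (M D) {y | medOK D y.val}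
    change prob (M D) {y | medOK D y.val}ᶜ ≤ β
    rw [h2]
    change 1 - β ≤ prob (M D) {y | medOK D y.val} at h1
    linarith
  have hmany := prob_many_rows_bad_le hq1 hadv hM.1 (copyLaw A α τ m) bad hbad hsb hZ hchoose
  rw [hgoal]
  have := hsub.trans (prob_union_le P _ _)
  linarith

end Robust

/-! ### The exponential mechanism for the median -/

section ExpMech

theorem card_filter_le_succ {k : ℕ} {X : Type*} {D D' : Fin k → X} {i : Fin k} (h : ∀ j, j ≠ i → D j = D' j)
    (R : X → Prop) [DecidablePred R] :
    (Finset.univ.filter fun j => R (D j)).card ≤ (Finset.univ.filter fun j => R (D' j)).card + 1 := by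
  refine le_trans (Finset.card_le_card fun j hj => ?_)
    (Finset.card_insert_le i (Finset.univ.filter fun j => R (D' j)))
  rw [Finset.mem_insert]
  by_cases hji : j = i
  · exact Or.inl hji
  · rw [Finset.mem_filter, h j hji] at hj
    exact Or.inr (Finset.mem_filter.2 hj)

variable {k : ℕ} {X : Type*} [LinearOrder X]

/-- The smaller one of the numbers of rows that are at least `x` and at most `x`. -/
def medianScore (D : Fin k → X) (x : X) : ℕ :=
  min (Finset.univ.filter fun i => x ≤ D i).card (Finset.univ.filter fun i => D i ≤ x).card

theorem medianScore_le_succ {D D' : Fin k → X} {i : Fin k} (h : ∀ j, j ≠ i → D j = D' j) (x : X) :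
    medianScore D x ≤ medianScore D' x + 1 := by
  have h1 := card_filter_le_succ h fun y => x ≤ y
  have h2 := card_filter_le_succ h fun y => y ≤ x
  unfold medianScore
  omega

/-- Take the largest `x` that at least half of the rows reach. If more than half of the rows
exceeded `x`, the smallest of these rows would be a larger candidate. -/
theorem exists_le_two_mul_medianScore [Fintype X] [Nonempty X] (D : Fin k → X) :
    ∃ x, k ≤ 2 * medianScore D x := by
  set S := Finset.univ.filter fun x => k ≤ 2 * (Finset.univ.filter fun i => x ≤ D i).card with hS
  have hSne : S.Nonempty := by
    refine ⟨Finset.univ.min' Finset.univ_nonempty, Finset.mem_filter.2 ⟨Finset.mem_univ _, ?_⟩⟩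
    rw [Finset.filter_true_of_mem fun i _ => Finset.min'_le _ _ (Finset.mem_univ _)]
    simp
    omega
  have hmem := (Finset.mem_filter.1 (S.max'_mem hSne)).2
  set x := S.max' hSne with hx
  refine ⟨x, ?_⟩
  suffices h : k ≤ 2 * (Finset.univ.filter fun i => D i ≤ x).card by
    unfold medianScore
    omega
  by_contra hcon
  have hsum : (Finset.univ.filter fun i => D i ≤ x).card
      + (Finset.univ.filter fun i => ¬ D i ≤ x).card = k := by
    rw [Finset.card_filter_add_card_filter_not]
    simp
  have hne : (Finset.univ.filter fun i => ¬ D i ≤ x).Nonempty := by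
    rw [← Finset.card_pos]
    omega
  obtain ⟨i, hi, hmin⟩ := Finset.exists_min_image _ D hne
  have hxi : x < D i := not_le.1 (Finset.mem_filter.1 hi).2
  have hDi : D i ∈ S := by
    refine Finset.mem_filter.2 ⟨Finset.mem_univ _, ?_⟩
    have : (Finset.univ.filter fun j => ¬ D j ≤ x) ⊆ Finset.univ.filter fun j => D i ≤ D j :=
      fun j hj => Finset.mem_filter.2 ⟨Finset.mem_univ _, hmin j hj⟩
    have := Finset.card_le_card this
    omega
  exact absurd (S.le_max' _ hDi) (not_le.2 hxi)

/-- Exponential mechanism with weights `exp (ε / 2 * score)`. A changed row moves each score by at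
most `1`, hence weight and normalizer by a factor `exp (ε / 2)` each. Some score is at least `k /
2`, so each failing value has probability at most `exp (-ε Γ / 2) ≤ β / |X|`. -/
theorem exists_isDPMedian [Fintype X] [Nonempty X] {ε β Γ : ℝ} (hε : 0 < ε) (hβ : 0 < β)
    (hΓ : 2 * ε⁻¹ * Real.log (Fintype.card X / β) ≤ Γ) :
    ∃ M : (Fin k → X) → PMF X, IsDPMedian M ε β Γ := by
  classical
  set w : (Fin k → X) → X → ℝ := fun D x => Real.exp (ε / 2 * medianScore D x) with hw
  have hw0 : ∀ D x, 0 < w D x := fun D x => Real.exp_pos _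
  set W : (Fin k → X) → ℝ := fun D => ∑ x, w D x with hWdef
  have hW0 : ∀ D, 0 < W D := fun D => Finset.sum_pos (fun x _ => hw0 D x) Finset.univ_nonempty
  have hsum : ∀ D, ∑ x, ENNReal.ofReal (w D x / W D) = 1 := fun D => by
    rw [← ENNReal.ofReal_sum_of_nonneg fun x _ => (div_pos (hw0 D x) (hW0 D)).le, ← Finset.sum_div,
      div_self (hW0 D).ne', ENNReal.ofReal_one]
  set M : (Fin k → X) → PMF X := fun D => PMF.ofFintype _ (hsum D) with hM
  have hMx : ∀ D x, (M D x).toReal = w D x / W D := fun D x =>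
    ENNReal.toReal_ofReal (div_pos (hw0 D x) (hW0 D)).le
  refine ⟨M, fun D D' hDD' T => ?_, fun D => ?_⟩
  · obtain ⟨i, hi⟩ := hDD'
    have hww : ∀ D D' : Fin k → X, (∀ j, j ≠ i → D j = D' j) → ∀ x,
        w D x ≤ Real.exp (ε / 2) * w D' x := fun D D' h x => by
      rw [hw, ← Real.exp_add]
      refine Real.exp_le_exp.2 ?_
      have : (medianScore D x : ℝ) ≤ medianScore D' x + 1 := by
        exact_mod_cast medianScore_le_succ h x
      nlinarith
    have hWW : W D' ≤ Real.exp (ε / 2) * W D := by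
      rw [hWdef, Finset.mul_sum]
      exact Finset.sum_le_sum fun x _ => hww D' D (fun j hj => (hi j hj).symm) x
    have hee : Real.exp ε = Real.exp (ε / 2) * Real.exp (ε / 2) := by
      rw [← Real.exp_add, add_halves]
    rw [add_zero, prob_eq_sum, prob_eq_sum, Finset.mul_sum]
    refine Finset.sum_le_sum fun x _ => ?_
    split_ifs
    · rw [hMx, hMx, hee, div_le_iff₀ (hW0 D)]
      have h1 := hww D D' hi x
      have h2 : 0 < w D' x / W D' := div_pos (hw0 _ _) (hW0 _)
      calc w D x ≤ Real.exp (ε / 2) * w D' x := h1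
        _ = Real.exp (ε / 2) * (w D' x / W D') * W D' := by
          rw [mul_assoc, div_mul_cancel₀ _ (hW0 D').ne']
        _ ≤ Real.exp (ε / 2) * (w D' x / W D') * (Real.exp (ε / 2) * W D) := by gcongr
        _ = _ := by ring
    · simp
  · set good : Set X := {x | (k : ℝ) / 2 - Γ ≤ ((Finset.univ.filter fun i => x ≤ D i).card : ℝ) ∧
      (k : ℝ) / 2 - Γ ≤ ((Finset.univ.filter fun i => D i ≤ x).card : ℝ)}
    obtain ⟨x₀, hx₀⟩ := exists_le_two_mul_medianScore D
    have hx₀' : (k : ℝ) ≤ 2 * medianScore D x₀ := by exact_mod_cast hx₀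
    have hWlow : Real.exp (ε / 2 * (k / 2)) ≤ W D := by
      refine le_trans ?_ (Finset.single_le_sum (fun x _ => (hw0 D x).le) (Finset.mem_univ x₀))
      refine Real.exp_le_exp.2 ?_
      nlinarith
    have hcardpos : (0 : ℝ) < Fintype.card X := by exact_mod_cast Fintype.card_pos
    have hterm : ∀ x ∈ goodᶜ, (M D x).toReal ≤ β / Fintype.card X := fun x hx => by
      have hs : (medianScore D x : ℝ) ≤ k / 2 - Γ := by
        by_contra hcon
        rw [not_le] at hcon
        refine hx ⟨hcon.le.trans ?_, hcon.le.trans ?_⟩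
        · exact_mod_cast min_le_left _ _
        · exact_mod_cast min_le_right _ _
      have h1 : Real.log (Fintype.card X / β) ≤ ε / 2 * Γ := by
        calc Real.log (Fintype.card X / β)
            = ε / 2 * (2 * ε⁻¹ * Real.log (Fintype.card X / β)) := by field_simp
          _ ≤ ε / 2 * Γ := by gcongr
      have h2 : Real.exp (-(ε / 2 * Γ)) ≤ β / Fintype.card X := by
        rw [← Real.exp_log (div_pos hβ hcardpos)]
        refine Real.exp_le_exp.2 ?_
        rw [← inv_div (Fintype.card X : ℝ) β, Real.log_inv]
        linarith
      refine le_trans ?_ h2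
      rw [hMx, div_le_iff₀ (hW0 D)]
      calc w D x ≤ Real.exp (-(ε / 2 * Γ)) * Real.exp (ε / 2 * (k / 2)) := by
            rw [← Real.exp_add]
            refine Real.exp_le_exp.2 ?_
            nlinarith
        _ ≤ _ := by gcongr
    have hbad : prob (M D) goodᶜ ≤ β := by
      rw [prob_eq_sum]
      calc ∑ x, (if x ∈ goodᶜ then (M D x).toReal else 0)
          ≤ ∑ _x : X, β / Fintype.card X := Finset.sum_le_sum fun x _ => by
            split_ifs with hx
            · exact hterm x hx
            · positivity
        _ = β := by
            rw [Finset.sum_const, Finset.card_univ, nsmul_eq_mul, mul_div_cancel₀ _ hcardpos.ne']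
    rw [prob_compl] at hbad
    linarith

end ExpMech

/-! ### Estimates of the parameters -/

section Parameters

theorem log_one_div_deltaPrime {q : ℕ} {δ : ℝ} :
    Real.log (1 / deltaPrime q δ) = Real.log (1000 * q / δ) := by
  congr 1
  rw [deltaPrime, epsTotal, one_div_div]
  rcases eq_or_ne δ 0 with rfl | h
  · simp
  · field_simp
    ring

theorem log_two_le_log {q : ℕ} {δ : ℝ} (hq : 1 ≤ q) (hδ : 0 < δ) (hδ1 : δ < 1) :
    Real.log 2 ≤ Real.log (2 * q / δ) := by
  have hq' : (1 : ℝ) ≤ q := by exact_mod_cast hq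
  refine Real.log_le_log two_pos ?_
  rw [le_div_iff₀ hδ]
  nlinarith

theorem log_thousand_le {q : ℕ} {δ : ℝ} (hq : 1 ≤ q) (hδ : 0 < δ) (hδ1 : δ < 1) :
    Real.log (1000 * q / δ) ≤ 10 * Real.log (2 * q / δ) := by
  have hq' : (0 : ℝ) < q := by exact_mod_cast hq
  have h1 : 1000 * q / δ = 500 * (2 * q / δ) := by ring
  have h2 : Real.log 500 ≤ 9 * Real.log 2 := by
    rw [← Real.log_rpow two_pos]
    exact Real.log_le_log (by norm_num) (by norm_num)
  rw [h1, Real.log_mul (by norm_num) (by positivity)]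
  linarith [log_two_le_log hq hδ hδ1]

theorem log_le_log_thousand {q : ℕ} {δ : ℝ} (hq : 1 ≤ q) (hδ : 0 < δ) :
    Real.log (2 * q / δ) ≤ Real.log (1000 * q / δ) := by
  have hq' : (0 : ℝ) < q := by exact_mod_cast hq
  refine Real.log_le_log (by positivity) ?_
  gcongr
  norm_num

/-- A factor is needed because `log (2 τ) / α` can be below `1`. It exceeds `log 2`, and `(log 2) ^
4 * 2 ^ 3 ≥ 1` bounds the loss by `3/4 * log 2`. -/
theorem log_le_four_mul_log {q : ℕ} {α δ τ : ℝ} (hq : 1 ≤ q) (hα : 0 < α) (hα1 : α < 1)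
    (hδ : 0 < δ) (hδ1 : δ < 1) (hτ : 1 ≤ τ) :
    Real.log (2 * q / δ) ≤ 4 * Real.log (2 * q * Real.log (2 * τ) / (α * δ)) := by
  have hq' : (0 : ℝ) < q := by exact_mod_cast hq
  have hl2 := Real.log_two_gt_d9
  have hlog2 : Real.log 2 ≤ Real.log (2 * τ) := Real.log_le_log two_pos (by linarith)
  have h1 : 2 * q / δ * Real.log 2 ≤ 2 * q * Real.log (2 * τ) / (α * δ) := by
    rw [div_mul_eq_mul_div, div_le_div_iff₀ hδ (by positivity)]
    have h2 : α * Real.log 2 ≤ Real.log (2 * τ) := by nlinarith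
    have h3 : 0 ≤ 2 * q * δ := by positivity
    nlinarith
  have h2 := Real.log_le_log (by positivity) h1
  rw [Real.log_mul (by positivity) (by positivity)] at h2
  have h3 : 0 ≤ 4 * Real.log (Real.log 2) + 3 * Real.log 2 := by
    have : 4 * Real.log (Real.log 2) + 3 * Real.log 2 = Real.log (Real.log 2 ^ 4 * 2 ^ 3) := by
      rw [Real.log_mul (by positivity) (by positivity), Real.log_pow, Real.log_pow]
      norm_num
    rw [this]
    refine Real.log_nonneg ?_
    have : (0.69 : ℝ) ^ 4 ≤ Real.log 2 ^ 4 := by gcongr; linarith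
    nlinarith
  linarith [log_two_le_log hq hδ hδ1]

theorem card_grid_le {α τ : ℝ} (hα : 0 < α) (hα1 : α < 1) (hτ : 1 ≤ τ) :
    ((grid α τ).card : ℝ) ≤ 4 * Real.log (2 * τ) / α := by
  have h1 : (grid α τ).card ≤ maxExp α τ + 2 :=
    (Finset.card_insert_le _ _).trans
      (Nat.succ_le_succ (Finset.card_image_le.trans (Finset.card_range _).le))
  have h2 : ((grid α τ).card : ℝ) ≤ maxExp α τ + 2 := by exact_mod_cast h1
  have hlt : 0 ≤ Real.log τ := Real.log_nonneg hτ
  have h3 : α / 4 ≤ Real.log (1 + α / 3) := by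
    have h4 := Real.one_sub_inv_le_log_of_pos (show 0 < 1 + α / 3 by linarith)
    refine le_trans ?_ h4
    rw [← one_div, le_sub_iff_add_le, ← le_sub_iff_add_le', div_le_iff₀ (by linarith)]
    nlinarith
  have h4 : (maxExp α τ : ℝ) ≤ 4 * Real.log τ / α := by
    refine (Nat.floor_le (Real.logb_nonneg (by linarith) hτ)).trans ?_
    rw [Real.logb, div_le_div_iff₀ (by linarith) hα]
    nlinarith
  have h5 : (2 : ℝ) ≤ 4 * Real.log 2 / α := by
    rw [le_div_iff₀ hα]
    linarith [Real.log_two_gt_d9]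
  rw [Real.log_mul two_ne_zero (by linarith), mul_add, add_div]
  linarith

theorem log_card_grid_le {q : ℕ} {α δ τ : ℝ} (hq : 1 ≤ q) (hα : 0 < α) (hα1 : α < 1)
    (hδ : 0 < δ) (hδ1 : δ < 1) (hτ : 1 ≤ τ) :
    Real.log ((grid α τ).card / (δ / (2 * q)))
      ≤ 9 * Real.log (2 * q * Real.log (2 * τ) / (α * δ)) := by
  have hq' : (0 : ℝ) < q := by exact_mod_cast hq
  have hl : 0 < Real.log (2 * τ) := Real.log_pos (by linarith)
  have hc : (0 : ℝ) < (grid α τ).card := by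
    exact_mod_cast Finset.card_pos.2 ⟨0, Finset.mem_insert_self _ _⟩
  have h1 : (grid α τ).card / (δ / (2 * q)) ≤ 2 ^ 2 * (2 * q * Real.log (2 * τ) / (α * δ)) := by
    calc (grid α τ).card / (δ / (2 * q)) ≤ 4 * Real.log (2 * τ) / α / (δ / (2 * q)) := by
          gcongr
          exact card_grid_le hα hα1 hτ
      _ = _ := by field_simp; norm_num
  have h2 := Real.log_le_log (by positivity) h1
  rw [Real.log_mul (by norm_num) (by positivity), Real.log_pow] at h2
  push_cast at h2
  linarith [log_two_le_log hq hδ hδ1, log_le_four_mul_log hq hα hα1 hδ hδ1 hτ]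

/-- Factor by factor in the descending factorials: `(k - i) / (b - i) ≤ 5/2` for `i ≤ k / 20` and `b
≥ 9 k / 20`. -/
theorem choose_le_pow_mul_choose {k b s : ℕ} (hs : 20 * s ≤ k) (hb : 9 * k ≤ 20 * b) :
    (k.choose s : ℝ) ≤ (5 / 2) ^ s * b.choose s := by
  have h1 : ∀ i ≤ s, (k.descFactorial i : ℝ) ≤ (5 / 2) ^ i * b.descFactorial i := by
    intro i
    induction i with
    | zero => simp
    | succ i ih =>
      intro hi
      rw [Nat.descFactorial_succ, Nat.descFactorial_succ, Nat.cast_mul, Nat.cast_mul,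
        Nat.cast_sub (by omega), Nat.cast_sub (by omega), pow_succ]
      have h2 : (k : ℝ) - i ≤ 5 / 2 * (b - i) := by
        have h3 : 2 * k + 3 * i ≤ 5 * b := by omega
        have h4 : 2 * (k : ℝ) + 3 * i ≤ 5 * b := by exact_mod_cast h3
        linarith
      have h5 : (0 : ℝ) ≤ (b : ℝ) - i := by
        have : i ≤ b := by omega
        have : (i : ℝ) ≤ b := by exact_mod_cast this
        linarith
      calc ((k : ℝ) - i) * k.descFactorial i
          ≤ (5 / 2 * (b - i)) * ((5 / 2) ^ i * b.descFactorial i) := by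
            gcongr
            exact ih (by omega)
        _ = _ := by ring
  have h2 := h1 s le_rfl
  rw [Nat.descFactorial_eq_factorial_mul_choose, Nat.descFactorial_eq_factorial_mul_choose] at h2
  push_cast at h2
  have h3 : (0 : ℝ) < s.factorial := by exact_mod_cast Nat.factorial_pos s
  nlinarith

end Parameters

/-! ### The privacy parameter, the group size and the space -/

section MainParameters

theorem inv_epsPrime {q : ℕ} {δ : ℝ} :
    (epsPrime q δ)⁻¹ = 100 * Real.sqrt (8 * q * Real.log (1000 * q / δ)) := by
  rw [epsPrime, log_one_div_deltaPrime, inv_div, epsTotal]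
  ring

theorem hundred_le_inv_epsPrime {q : ℕ} {δ : ℝ} (hq : 1 ≤ q) (hδ : 0 < δ) (hδ1 : δ < 1) :
    100 ≤ (epsPrime q δ)⁻¹ := by
  have hq' : (1 : ℝ) ≤ q := by exact_mod_cast hq
  have h1 := log_two_le_log hq hδ hδ1
  have h2 := log_le_log_thousand hq hδ
  have h3 : 1 ≤ Real.sqrt (8 * q * Real.log (1000 * q / δ)) := by
    rw [Real.one_le_sqrt]
    nlinarith [Real.log_two_gt_d9]
  rw [inv_epsPrime]
  linarith

theorem inv_epsPrime_le {q : ℕ} {δ : ℝ} (hq : 1 ≤ q) (hδ : 0 < δ) (hδ1 : δ < 1) :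
    (epsPrime q δ)⁻¹ ≤ 900 * Real.sqrt (q * Real.log (2 * q / δ)) := by
  have hl : 0 < Real.log (2 * q / δ) :=
    (Real.log_pos one_lt_two).trans_le (log_two_le_log hq hδ hδ1)
  have h1 : Real.sqrt (8 * q * Real.log (1000 * q / δ))
      ≤ Real.sqrt (9 ^ 2 * (q * Real.log (2 * q / δ))) := by
    refine Real.sqrt_le_sqrt ?_
    have h2 := mul_le_mul_of_nonneg_left (log_thousand_le hq hδ hδ1)
      (show (0 : ℝ) ≤ 8 * q by positivity)
    have h3 : 0 ≤ q * Real.log (2 * q / δ) := by positivity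
    linarith
  rw [Real.sqrt_mul (by norm_num : (0 : ℝ) ≤ 9 ^ 2), Real.sqrt_sq (by norm_num)] at h1
  rw [inv_epsPrime]
  linarith

/-- The number of rows that are resampled together. -/
def groupSize (q : ℕ) (δ : ℝ) : ℕ := ⌈5 * Real.log (2 * q / δ)⌉₊

theorem groupSize_le {q : ℕ} {δ : ℝ} (hq : 1 ≤ q) (hδ : 0 < δ) (hδ1 : δ < 1) :
    (groupSize q δ : ℝ) ≤ 7 * Real.log (2 * q / δ) := by
  have h1 := log_two_le_log hq hδ hδ1
  have h2 := Real.log_two_gt_d9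
  have h3 := Nat.ceil_lt_add_one (show 0 ≤ 5 * Real.log (2 * q / δ) by linarith)
  rw [groupSize]
  linarith

/-- `ε' ^ 2` is `1 / (80000 q log (1000 q / δ))`, and one factor `s ≤ 7 log (1000 q / δ)` cancels
the logarithm. The total exponent `q (s ε') ^ 2` is thus at most `s / 10000`, linear in `s`. -/
theorem exp_groupSize_le {q : ℕ} {δ : ℝ} (hq : 1 ≤ q) (hδ : 0 < δ) (hδ1 : δ < 1) :
    Real.exp ((groupSize q δ * epsPrime q δ) ^ 2) ^ q ≤ (128 / 125) ^ groupSize q δ := by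
  have hq' : (0 : ℝ) < q := by exact_mod_cast hq
  have hl : 0 < Real.log (1000 * q / δ) := (Real.log_pos one_lt_two).trans_le
    ((log_two_le_log hq hδ hδ1).trans (log_le_log_thousand hq hδ))
  have hs := (groupSize_le hq hδ hδ1).trans
    (mul_le_mul_of_nonneg_left (log_le_log_thousand hq hδ) (by norm_num))
  set s := groupSize q δ
  have h1 : (q : ℝ) * (s * epsPrime q δ) ^ 2 ≤ s * (1 / 10000) := by
    have h2 : epsPrime q δ = (100 * Real.sqrt (8 * q * Real.log (1000 * q / δ)))⁻¹ := by
      rw [← inv_epsPrime, inv_inv]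
    rw [h2, mul_pow, inv_pow, mul_pow, Real.sq_sqrt (by positivity), ← mul_assoc,
      ← div_eq_mul_inv, div_le_iff₀ (by positivity)]
    have h3 : (q : ℝ) * s * s ≤ q * s * (7 * Real.log (1000 * q / δ)) := by gcongr
    have h4 : 0 ≤ q * s * Real.log (1000 * q / δ) := by positivity
    nlinarith
  have h5 : Real.exp (1 / 10000) ≤ 128 / 125 := by
    have h6 := Real.add_one_le_exp (-(1 / 10000))
    rw [Real.exp_neg] at h6
    rw [← inv_inv (Real.exp _)]
    refine (inv_anti₀ (by norm_num) h6).trans (by norm_num)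
  calc Real.exp ((s * epsPrime q δ) ^ 2) ^ q = Real.exp (q * (s * epsPrime q δ) ^ 2) :=
        (Real.exp_nat_mul _ _).symm
    _ ≤ Real.exp (s * (1 / 10000)) := Real.exp_le_exp.2 h1
    _ = Real.exp (1 / 10000) ^ s := Real.exp_nat_mul _ _
    _ ≤ (128 / 125) ^ s := by gcongr

/-- The constant `5` in `groupSize` matches `4/5 ≤ exp (-1/5)`. -/
theorem mul_pow_groupSize_le {q : ℕ} {δ : ℝ} (hq : 1 ≤ q) (hδ : 0 < δ) :
    q * (4 / 5 : ℝ) ^ groupSize q δ ≤ δ / 2 := by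
  have hq' : (0 : ℝ) < q := by exact_mod_cast hq
  have h1 : (4 / 5 : ℝ) ≤ Real.exp (-(1 / 5)) := by
    linarith [Real.add_one_le_exp (-(1 / 5))]
  have h2 : (4 / 5 : ℝ) ^ groupSize q δ ≤ δ / (2 * q) := by
    calc (4 / 5 : ℝ) ^ groupSize q δ ≤ Real.exp (-(1 / 5)) ^ groupSize q δ := by gcongr
      _ = Real.exp (groupSize q δ * -(1 / 5)) := (Real.exp_nat_mul _ _).symm
      _ ≤ Real.exp (Real.log (δ / (2 * q))) := by
        refine Real.exp_le_exp.2 ?_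
        rw [← inv_div (2 * (q : ℝ)) δ, Real.log_inv]
        have : 5 * Real.log (2 * q / δ) ≤ groupSize q δ := Nat.le_ceil _
        linarith
      _ = δ / (2 * q) := Real.exp_log (by positivity)
  calc q * (4 / 5 : ℝ) ^ groupSize q δ ≤ q * (δ / (2 * q)) := by gcongr
    _ = δ / 2 := by field_simp

theorem usesSpace_boundedQueryAlg {n : ℕ} {A : StreamAlg n} {α τ : ℝ} {k w : ℕ} {S x : ℝ}
    (M : (Fin k → grid α τ) → PMF (grid α τ)) (hA : A.UsesSpace w S) (hx : k ≤ x) :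
    (boundedQueryAlg A α τ k M).UsesSpace w (x * S) := by
  obtain ⟨hfin, hcard⟩ := hA
  have hfin' : Finite (Fin k → A.State) := inferInstance
  refine ⟨hfin', ?_⟩
  -- A nonempty memory forces `w S ≥ 0`, so replacing `k` by the larger `x` cannot shrink the bound.
  have hne : Nonempty A.State := A.init.support_nonempty.to_subtype.map Subtype.val
  have h1 : (1 : ℝ) ≤ (2 : ℝ) ^ ((w : ℝ) * S) :=
    le_trans (by exact_mod_cast Nat.card_pos) hcard
  have h2 : 0 ≤ (w : ℝ) * S := by
    by_contra! h
    exact absurd h1 (not_le.2 (Real.rpow_lt_one_of_one_lt_of_neg one_lt_two h))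
  change ((Nat.card (Fin k → A.State) : ℕ) : ℝ) ≤ _
  rw [Nat.card_fun, Nat.card_fin, Nat.cast_pow]
  calc (Nat.card A.State : ℝ) ^ k ≤ ((2 : ℝ) ^ ((w : ℝ) * S)) ^ k := by gcongr
    _ = (2 : ℝ) ^ ((w : ℝ) * S * k) := by rw [Real.rpow_mul zero_le_two ((w : ℝ) * S), Real.rpow_natCast]
    _ ≤ (2 : ℝ) ^ ((w : ℝ) * (x * S)) := by
      refine Real.rpow_le_rpow_of_exponent_le one_le_two ?_
      nlinarith

end MainParameters

end RobustStreaming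

end

/-! ### The main theorem: choice of the constants -/

open RobustStreaming
theorem mainTheorem2 :
    ∃ c₀ : ℝ, 0 < c₀ ∧ ∀ c : ℝ, c₀ ≤ c →
    ∃ C₀ : ℝ, 0 < C₀ ∧ ∀ C : ℝ, C₀ ≤ C →
    ∃ K : ℝ, 0 < K ∧
    ∀ (n m q w : ℕ) (α δ τ S : ℝ) (f : (Fin n → ℤ) → ℝ) (A : StreamAlg n),
      1 ≤ q → 0 < α → α < 1 → 0 < δ → δ < 1 → 1 ≤ τ →
      (∀ us : List (Update n), us ≠ [] → us.length ≤ m →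
        f (freq us) = 0 ∨ (1 ≤ f (freq us) ∧ f (freq us) ≤ τ)) →
      A.IsOblivious f (α / 3) m (9 / 10) →
      A.UsesSpace w S →
      (∃ M : (Fin (numCopies C q α δ τ) → grid α τ) → PMF (grid α τ),
        IsDPMedian M (epsPrime q δ) (δ / (2 * q)) (medianError c q α δ τ)) ∧
      ∀ M : (Fin (numCopies C q α δ τ) → grid α τ) → PMF (grid α τ),
        IsDPMedian M (epsPrime q δ) (δ / (2 * q)) (medianError c q α δ τ) →
        (boundedQueryAlg A α τ (numCopies C q α δ τ) M).IsRobust f α m q (1 - δ) ∧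
        (boundedQueryAlg A α τ (numCopies C q α δ τ) M).UsesSpace w
          (K * (Real.sqrt (q * Real.log (2 * q / δ)) *
            Real.log (2 * q * Real.log (2 * τ) / (α * δ))) * S) := by
  -- `2` is the constant of the exponential mechanism. As `Γ ≤ 9 c e L`, the term `180 c` gives `20
  -- Γ`, and `6` leaves room for `20` and for `20 * groupSize`. In `K`, `900` comes from
  -- `inv_epsPrime_le` and `10` absorbs the rounding of `k`.
  refine ⟨2, two_pos, fun c hc => ⟨180 * c + 6, by linarith, fun C hC => ⟨900 * C + 10, by linarith,
    fun n m q w α δ τ S f A hq hα hα1 hδ hδ1 hτ hf hA hS => ?_⟩⟩⟩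
  have hq' : (1 : ℝ) ≤ q := by exact_mod_cast hq
  have hl2 := Real.log_two_gt_d9
  have hlog := log_two_le_log hq hδ hδ1
  have hlogL := log_le_four_mul_log hq hα hα1 hδ hδ1 hτ
  have hgrid := log_card_grid_le hq hα hα1 hδ hδ1 hτ
  have hE := hundred_le_inv_epsPrime hq hδ hδ1
  have hE' := inv_epsPrime_le hq hδ hδ1
  set l := Real.log (2 * q / δ) with hl
  set L := Real.log (2 * q * Real.log (2 * τ) / (α * δ)) with hL
  set e := (epsPrime q δ)⁻¹ with he
  set k := numCopies C q α δ τ with hk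
  set Γ := medianError c q α δ τ with hΓ
  have hL0 : 0 < L := by linarith
  have hCeL : 0 ≤ C * e * L := mul_nonneg (mul_nonneg (by linarith) (by linarith)) hL0.le
  have hk1 : C * e * L ≤ k := Nat.le_ceil _
  have hk2 : (k : ℝ) ≤ C * e * L + 1 := (Nat.ceil_lt_add_one hCeL).le
  have heL : 100 * L ≤ e * L := by gcongr
  have heL0 : 0 < e * L := by linarith
  have hkeL : (180 * c + 6) * (e * L) ≤ k := by
    refine le_trans ?_ hk1
    rw [mul_assoc]
    gcongr
  refine ⟨?_, fun M hM => ⟨?_, ?_⟩⟩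
  · have : Nonempty (grid α τ) := ⟨⟨0, Finset.mem_insert_self _ _⟩⟩
    refine exists_isDPMedian (inv_pos.1 (lt_of_lt_of_le (by norm_num) hE)) (by positivity) ?_
    rw [hΓ, medianError, Fintype.card_coe, ← he]
    have hlogc : 0 ≤ Real.log ((grid α τ).card / (δ / (2 * q))) := by
      refine Real.log_nonneg ?_
      have h1 : (1 : ℝ) ≤ (grid α τ).card := by
        exact_mod_cast Finset.card_pos.2 ⟨0, Finset.mem_insert_self _ _⟩
      rw [le_div_iff₀ (by positivity), one_mul]
      refine le_trans ?_ h1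
      rw [div_le_one (by positivity)]
      linarith
    gcongr
  · have hΓk : Γ + 1 ≤ k / 20 := by
      have h1 : Γ ≤ c * e * (9 * L) := by
        rw [hΓ, medianError, ← he]
        gcongr
      linarith
    have hs : 20 * groupSize q δ ≤ k := by
      have h1 : (20 * groupSize q δ : ℝ) ≤ k := by
        have h2 := groupSize_le hq hδ hδ1
        have h3 : 0 ≤ c * (e * L) := by positivity
        linarith
      exact_mod_cast h1
    have hb : ((9 * k / 20 + 1 : ℕ) : ℝ) ≤ k / 2 - Γ := by
      have : ((9 * k / 20 : ℕ) : ℝ) ≤ ((9 * k : ℕ) : ℝ) / ((20 : ℕ) : ℝ) := Nat.cast_div_le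
      push_cast at this ⊢
      linarith
    intro adv hadv
    refine le_trans ?_ (isRobust_boundedQueryAlg f A hq hα hα1 (by positivity) hf hA hM
      -- The `+ 1` compensates the floor, so that `9 k ≤ 20 b`; `Γ + 1 ≤ k / 20` pays for it.
      (s := groupSize q δ) (b := 9 * k / 20 + 1) (by omega) hb (exp_groupSize_le hq hδ hδ1)
      (choose_le_pow_mul_choose hs (by omega)) adv hadv)
    have h1 := mul_pow_groupSize_le hq hδ
    have h2 : q * (δ / (2 * q)) = δ / 2 := by field_simp
    linarith
  · refine usesSpace_boundedQueryAlg M hS ?_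
    have hR : 4 / 5 ≤ Real.sqrt (q * l) := by
      refine Real.le_sqrt_of_sq_le ?_
      nlinarith
    have h1 : C * e * L ≤ C * (900 * Real.sqrt (q * l)) * L := by
      have : 0 ≤ C := by linarith
      gcongr
    have h2 : 4 / 5 * L ≤ Real.sqrt (q * l) * L := by gcongr
    linarith
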